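/- Let $d\ge 1$, let $\varepsilon=1/(2m)$ with $m\in\mathbb N$, $m\ge 1$, let $\alpha,\beta\ge 0$ and $N:=(2\varepsilon)^{-d}$. On $D=(0,1)^d$ consider the periodic potential $V$ of mesh width $\varepsilon$: $V=\alpha$ on every cube $\varepsilon(z+[0,1)^d)$ with $z\in\mathbb Z^d$, $z_i\equiv s_i \pmod 2$ for all $i$ (where $s\in\mathbb Z^d$ is a fixed offset), and $V=\beta$ on all other cubes of the mesh. Thus there are $N$ isolated $\alpha$-cubes of side length $\varepsilon$. Let $E^1\le E^2\le\dots$ be the eigenvalues, counted with multiplicity, of the weak eigenvalue problem: find $0\ne u\in H^1_{\mathrm{per}}(D)$ and $E\in\mathbb R$ with $$\int_D \nabla u\cdot\nabla v+Vuv\,dx = E\int_D uv\,dx\qquad\text{for all } v\in H^1_{\mathrm{per}}(D);$$ the eigenvalue $E^k$ exists for every $k\ge 1$. Let $c_\alpha,c_\beta>0$. All constants below are independent of $\varepsilon,\alpha,\beta,s,\ell,k$. Throughout, $\ell$ and $k$ are natural numbers. (1) There is $c=c(d,c_\beta)>0$ such that for all $\ell\ge1$: if $\beta\ge c_\beta(\ell-1)^2\varepsilon^{-2}$,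 then $E^{N\ell^d+1}\ge c\,(\ell-1)^2/\varepsilon^2$. (2) There is $C=C(d,c_\alpha)>0$ such that, if $\alpha\le c_\alpha\varepsilon^{-2}$, then $E^{N\ell}\le C\,\ell^2/\varepsilon^2$ for all $\ell\ge 1$. (3) There is $C=C(d,c_\alpha,c_\beta)>0$ such that, if $\ell>1$, $\alpha\le c_\alpha\varepsilon^{-2}$ and $\beta\ge c_\beta(\ell-1)^2\varepsilon^{-2}$, then $$\frac{E^{Nk}}{E^{N\ell^d+1}}\le C\,\frac{k^2}{(\ell-1)^2}\quad\text{for all } 1\le k<\ell,\qquad\text{and}\qquad \frac{E^{1}}{E^{N\ell^d+1}}\le \frac{C}{(\ell-1)^2}.$$ (4) Large gaps appear only after $O(\varepsilon^{-d})$ eigenvalues. First, there is $C=C(d,c_\alpha,c_\beta)>0$ such that, if $\alpha\le c_\alpha\varepsilon^{-2}$ and $\beta\ge c_\beta\varepsilon^{-2}$, then the first $N=(2\varepsilon)^{-d}$ eigenvalues are comparable: $E^N\le C\,E^1$. Second, for every $\delta>0$ there are $K\in\mathbb N$, $K\ge1$, and $B>0$, depending only on $d,c_\alpha,\delta$, such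 that, if $\alpha\le c_\alpha\varepsilon^{-2}$ and $\beta\ge B\varepsilon^{-2}$, then $E^{N}/E^{KN+1}\le\delta$. -/

import Mathlib

open MeasureTheory
open scoped ContDiff

namespace SchroedingerPer

/-- The open unit cube `D = (0,1)^d`. -/
def unitCube (d : ℕ) : Set (Fin d → ℝ) := Set.univ.pi fun _ => Set.Ioo 0 1

/-- The real Hilbert space `L²(D)`. -/
abbrev L2D (d : ℕ) : Type := Lp ℝ 2 ((volume : Measure (Fin d → ℝ)).restrict (unitCube d))

/-- Smooth `ℤ^d`-periodic test functions on `ℝ^d`. -/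
def IsPeriodicTest {d : ℕ} (φ : (Fin d → ℝ) → ℝ) : Prop :=
  ContDiff ℝ ∞ φ ∧ ∀ (x : Fin d → ℝ) (k : Fin d → ℤ), φ (x + fun i => (k i : ℝ)) = φ x

/-- `g = (g_1, …, g_d)` is the weak gradient of `u` on the torus `ℝ^d / ℤ^d`:
`∫_D u ∂_i φ = - ∫_D g_i φ` for all smooth periodic `φ` and all `i`. -/
def IsPeriodicWeakGradient {d : ℕ} (u : L2D d) (g : Fin d → L2D d) : Prop :=
  ∀ φ : (Fin d → ℝ) → ℝ, IsPeriodicTest φ → ∀ i : Fin d,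
    ∫ x in unitCube d, u x * fderiv ℝ φ x (Pi.single i 1) = - ∫ x in unitCube d, g i x * φ x

/-- `(u, E)` is an eigenpair of `-Δ + V` with periodic boundary conditions: `u` is a nonzero
element of `H¹_per(D)` (it has a periodic weak gradient in `L²(D)`) and
`∫_D ∇u · ∇v + V u v = E ∫_D u v` for every `v` in `H¹_per(D)`. -/
def IsEigenpair {d : ℕ} (V : (Fin d → ℝ) → ℝ) (u : L2D d) (E : ℝ) : Prop :=
  u ≠ 0 ∧ ∃ gu : Fin d → L2D d, IsPeriodicWeakGradient u gu ∧
    ∀ (v : L2D d) (gv : Fin d → L2D d), IsPeriodicWeakGradient v gv →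
      ∫ x in unitCube d, ((∑ i, gu i x * gv i x) + V x * u x * v x)
        = E * ∫ x in unitCube d, u x * v x

/-- The levels `t` such that there are at least `k` eigenvalues `≤ t`, counted with multiplicity
(`k` linearly independent eigenfunctions with eigenvalues `≤ t`). -/
def levelsAbove {d : ℕ} (V : (Fin d → ℝ) → ℝ) (k : ℕ) : Set ℝ :=
  {t | ∃ (u : Fin k → L2D d) (e : Fin k → ℝ), LinearIndependent ℝ u ∧
    ∀ j, IsEigenpair V (u j) (e j) ∧ e j ≤ t}

/-- The `k`-th eigenvalue `E^k` (`k ≥ 1`), eigenvalues being listed in nondecreasing order and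
repeated according to multiplicity. -/
noncomputable def eigenvalue {d : ℕ} (V : (Fin d → ℝ) → ℝ) (k : ℕ) : ℝ :=
  sInf (levelsAbove V k)

open scoped Classical in
/-- The periodic potential on the cubes of the mesh of width `ε`: it equals `α` on every cube
`ε (z + [0,1)^d)` whose index `z ∈ ℤ^d` satisfies `z_i ≡ s_i (mod 2)` for all `i`, and `β` on all
other cubes. The offset `s` only selects one of the `2^d` translates of the pattern. -/
noncomputable def periodicPotential {d : ℕ} (ε : ℝ) (s : Fin d → ℤ) (α β : ℝ) :
    (Fin d → ℝ) → ℝ :=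
  fun x => if ∀ i, Even (⌊x i / ε⌋ - s i) then α else β

/-- Admissible parameters: `ε⁻¹` is an even positive integer, `N = (2ε)^{-d}` is the number of
`α`-cubes in `D`, and the potential values are non-negative. -/
structure IsPeriodicSetting (d : ℕ) (ε : ℝ) (N : ℕ) (α β : ℝ) : Prop where
  eps_eq : ∃ m : ℕ, 0 < m ∧ ε = 1 / (2 * (m : ℝ))
  card_eq : (N : ℝ) = ((2 * ε) ^ d)⁻¹
  alpha_nonneg : 0 ≤ α
  beta_nonneg : 0 ≤ β

end SchroedingerPer

open SchroedingerPer

/-! ### Forms with compact embedding: variational principles -/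

namespace CompactForm

open Filter Topology
open scoped InnerProductSpace

variable {E X : Type*} [NormedAddCommGroup E] [InnerProductSpace ℝ E]
  [NormedAddCommGroup X] [InnerProductSpace ℝ X]

/-! The eigenvalues are those of the quadratic form `∫ |∇u|² + V u²`, and every estimate is a
min-max argument. If the form is at least `T ‖u‖²` for all `u` satisfying fewer than `k` linear
constraints, then `T ≤ E^k` (`le_of_mem_levels`). If it is at most `t ‖u‖²` on a `k`-dimensional
test space, then `E^k ≤ t` (`mem_levels`); this direction needs eigenvectors to exist, hence a
compact embedding. Compactness and attainment of the infimum both come from the Poincaré inequality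
on a fine mesh (`exists_constraints`).

Lower bound (`le_level_of_order`): cut every mesh cube into `l^d` subcells of side `ε / l`. Require
zero mean on the subcells inside the `α`-cubes, at most `N l^d` constraints. There Poincaré bounds
the energy below by a multiple of `l² / ε²`, and on all other subcells the potential `β` is already
large. The Poincaré inequality (`poincare`) is proved for smooth functions by integrating along
segments and extended to `H¹_per` by Fourier truncation.

Upper bound (`exists_mem_levelsAbove`): a bump rescaled into `l` subcells of each `α`-cube gives `N
l` test functions with disjoint supports and Rayleigh quotient at most a multiple of `l² / ε²`, plus
`α`. They never meet the region where `V = β`.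

The ratios in the gap statements are quotients of these bounds. Comparability of the first `N`
eigenvalues needs in addition `E^1 ≥ c / ε²`, where no constraint is available. On a period cell of
side `2ε` the `α`-part occupies at most half the volume, so a function with small gradient energy
must carry a fixed share of its mass in the `β`-part (`energy_ge_on_cell`). Arbitrarily large gaps
follow by fixing `l` large in terms of `δ`. -/

/-- The bilinear form `⟪u, v⟫ + ⟪M J u, J v⟫`. -/
noncomputable def form (J : E →L[ℝ] X) (M : X →L[ℝ] X) : E →ₗ[ℝ] E →ₗ[ℝ] ℝ :=
  LinearMap.mk₂ ℝ (fun u v => ⟪u, v⟫_ℝ + ⟪M (J u), J v⟫_ℝ)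
    (fun a b c => by simp only [map_add, inner_add_left]; ring)
    (fun r a b => by simp only [map_smul, inner_smul_left, smul_eq_mul]; simp; ring)
    (fun a b c => by simp only [map_add, inner_add_right]; ring)
    (fun r a b => by simp only [map_smul, inner_smul_right, smul_eq_mul]; ring)

variable {J : E →L[ℝ] X} {M : X →L[ℝ] X}

lemma form_apply (u v : E) : form J M u v = ⟪u, v⟫_ℝ + ⟪M (J u), J v⟫_ℝ := rfl

lemma form_comm (hM : ∀ x y, ⟪M x, y⟫_ℝ = ⟪x, M y⟫_ℝ) (u v : E) :
    form J M u v = form J M v u := by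
  rw [form_apply, form_apply, real_inner_comm u v, hM, real_inner_comm (M (J v))]

/-- `x` is an eigenvector with eigenvalue `e` of the form, relative to the embedding `J`. -/
def IsEigenvector (J : E →L[ℝ] X) (M : X →L[ℝ] X) (x : X) (e : ℝ) : Prop :=
  x ≠ 0 ∧ ∃ u : E, J u = x ∧ ∀ v, form J M u v = e * ⟪x, J v⟫_ℝ

/-- The levels below which there are `k` linearly independent eigenvectors. -/
def levels (J : E →L[ℝ] X) (M : X →L[ℝ] X) (k : ℕ) : Set ℝ :=
  {t | ∃ (x : Fin k → X) (e : Fin k → ℝ), LinearIndependent ℝ x ∧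
    ∀ j, IsEigenvector J M (x j) (e j) ∧ e j ≤ t}

lemma IsEigenvector.inner_eq_zero (hM : ∀ x y, ⟪M x, y⟫_ℝ = ⟪x, M y⟫_ℝ) {x y : X} {a b : ℝ}
    (hx : IsEigenvector J M x a) (hy : IsEigenvector J M y b) (hab : a ≠ b) :
    ⟪x, y⟫_ℝ = 0 := by
  obtain ⟨-, u, rfl, hu⟩ := hx
  obtain ⟨-, v, rfl, hv⟩ := hy
  have h1 := hu v
  rw [form_comm hM, hv u, real_inner_comm] at h1
  have : (a - b) * ⟪J u, J v⟫_ℝ = 0 := by linarith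
  exact (mul_eq_zero.1 this).resolve_left (sub_ne_zero.2 hab)

/-- If the form dominates `t₀ ‖·‖²` under fewer than `k` linear constraints, then `t₀` bounds the
levels of order `k` from below. -/
lemma le_of_mem_levels (hM : ∀ x y, ⟪M x, y⟫_ℝ = ⟪x, M y⟫_ℝ) {k : ℕ} {t t₀ : ℝ}
    (ht : t ∈ levels J M k) {ι : Type*} [Fintype ι] (hι : Fintype.card ι < k) (f : ι → X)
    (hf : ∀ u, (∀ i, ⟪f i, J u⟫_ℝ = 0) → t₀ * ‖J u‖ ^ 2 ≤ form J M u u) : t₀ ≤ t := by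
  obtain ⟨x, e, hlin, hx⟩ := ht
  choose hx ht using hx
  choose hx0 u hux hu using hx
  let L : (Fin k → ℝ) →ₗ[ℝ] (ι → ℝ) :=
    { toFun := fun c i => ∑ j, c j * ⟪f i, x j⟫_ℝ
      map_add' := fun a b => by ext i; simp [add_mul, Finset.sum_add_distrib]
      map_smul' := fun r a => by ext i; simp [mul_assoc, Finset.mul_sum] }
  obtain ⟨c, hcL, hc0⟩ : ∃ c, L c = 0 ∧ c ≠ 0 := by
    have : LinearMap.ker L ≠ ⊥ := LinearMap.ker_ne_bot_of_finrank_lt (by simpa using hι)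
    obtain ⟨c, hc, hc0⟩ := (Submodule.ne_bot_iff _).1 this
    exact ⟨c, hc, hc0⟩
  set w : E := ∑ j, c j • u j with hw
  have hJw : J w = ∑ j, c j • x j := by simp [hw, hux]
  have hJw0 : J w ≠ 0 := by
    intro h
    rw [hJw] at h
    exact hc0 (funext (Fintype.linearIndependent_iff.1 hlin c h))
  have h1 := hf w (fun i => by
    have := congrFun hcL i
    simp only [L, LinearMap.coe_mk, AddHom.coe_mk, Pi.zero_apply] at this
    rw [hJw, inner_sum]
    simpa [inner_smul_right] using this)
  have horth : ∀ j k, e j ≠ e k → ⟪x j, x k⟫_ℝ = 0 := fun j k hjk =>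
    IsEigenvector.inner_eq_zero hM ⟨hx0 j, u j, hux j, hu j⟩ ⟨hx0 k, u k, hux k, hu k⟩ hjk
  -- Cross terms with `e j ≠ e k` vanish by orthogonality, and for `e j = e k` the two square roots
  -- multiply to `t - e j`. The defect is thus an exact square, and no orthogonalisation inside an
  -- eigenspace is needed.
  have h2 : t * ‖J w‖ ^ 2 - form J M w w = ‖∑ j, (c j * √(t - e j)) • x j‖ ^ 2 := by
    have hq : form J M w w = ∑ j, ∑ k, c j * c k * e j * ⟪x j, x k⟫_ℝ := by
      conv_lhs => rw [hw]
      simp only [map_sum, map_smul, LinearMap.sum_apply, LinearMap.smul_apply, smul_eq_mul, hu,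
        hux]
      rw [Finset.sum_congr rfl fun j _ => by rw [Finset.mul_sum]]
      rw [Finset.sum_comm]
      exact Finset.sum_congr rfl fun j _ => Finset.sum_congr rfl fun k _ => by ring
    have hs : ∀ b : Fin k → ℝ, ‖∑ j, b j • x j‖ ^ 2 = ∑ j, ∑ k, b j * b k * ⟪x j, x k⟫_ℝ := by
      intro b
      rw [← real_inner_self_eq_norm_sq, sum_inner]
      refine Finset.sum_congr rfl fun j _ => ?_
      rw [inner_sum]
      refine Finset.sum_congr rfl fun k _ => ?_
      rw [inner_smul_left, inner_smul_right]; simp; ring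
    rw [hq, hJw, hs, hs, Finset.mul_sum, ← Finset.sum_sub_distrib]
    refine Finset.sum_congr rfl fun j _ => ?_
    rw [Finset.mul_sum, ← Finset.sum_sub_distrib]
    refine Finset.sum_congr rfl fun k _ => ?_
    by_cases hjk : e j = e k
    · rw [← hjk]
      have := Real.mul_self_sqrt (sub_nonneg.2 (ht j))
      linear_combination (-c j * c k * ⟪x j, x k⟫_ℝ) * this
    · rw [horth j k hjk]; ring
  have h3 : 0 ≤ t * ‖J w‖ ^ 2 - form J M w w := h2 ▸ sq_nonneg _
  have h4 : 0 < ‖J w‖ ^ 2 := by positivity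
  by_contra! h
  nlinarith

lemma levels_antitone {k l : ℕ} (h : k ≤ l) : levels J M l ⊆ levels J M k := by
  rintro t ⟨x, e, hlin, hx⟩
  exact ⟨fun j => x (Fin.castLE h j), fun j => e (Fin.castLE h j),
    hlin.comp _ (Fin.castLE_injective h), fun j => hx _⟩

/-- An embedding that is arbitrarily small under finitely many linear constraints is compact. -/
lemma isCompactOperator_of_constraints [CompleteSpace E] [CompleteSpace X]
    (h : ∀ ε : ℝ, 0 < ε → ∃ s : Finset X, ∀ u : E, (∀ x ∈ s, ⟪x, J u⟫_ℝ = 0) →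
      ‖J u‖ ≤ ε * ‖u‖) : IsCompactOperator J := by
  have key : ∀ n : ℕ, ∃ T : E →L[ℝ] X, IsCompactOperator T ∧ ‖J - T‖ ≤ 1 / ((n : ℝ) + 1) := by
    intro n
    obtain ⟨s, hs⟩ := h (1 / ((n : ℝ) + 1)) (by positivity)
    -- `Wᗮ` consists of the `u` satisfying all the constraints. Hence `J` composed with the
    -- projection onto `W` has finite rank, and the remainder is small by hypothesis.
    let W : Submodule ℝ E := Submodule.span ℝ ((fun x => J.adjoint x) '' (s : Set X))
    have : FiniteDimensional ℝ W :=
      FiniteDimensional.span_of_finite ℝ (s.finite_toSet.image _)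
    have hc : IsCompactOperator (W.starProjection : E →L[ℝ] E) := by
      have h1 : IsCompactOperator (id : W → W) := isCompactOperator_id_iff_finiteDimensional.2 ‹_›
      have h2 := (h1.comp_clm W.orthogonalProjectionOnto).clm_comp W.subtypeL
      exact h2
    refine ⟨J.comp W.starProjection, hc.clm_comp J, ?_⟩
    refine ContinuousLinearMap.opNorm_le_bound _ (by positivity) fun u => ?_
    have h3 : (J - J.comp W.starProjection) u = J (u - W.starProjection u) := by simp
    have h4 : u - W.starProjection u ∈ Wᗮ := W.sub_starProjection_mem_orthogonal u
    rw [h3]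
    refine (hs _ fun x hx => ?_).trans ?_
    · have : J.adjoint x ∈ W := Submodule.subset_span ⟨x, hx, rfl⟩
      rw [← ContinuousLinearMap.adjoint_inner_left]
      exact h4 _ this
    · gcongr
      have h5 := Wᗮ.norm_starProjection_apply_le u
      rwa [Submodule.starProjection_orthogonal_val] at h5
  choose T hT hTn using key
  refine isCompactOperator_of_tendsto (l := atTop) (F := T) ?_ (Eventually.of_forall hT)
  rw [tendsto_iff_norm_sub_tendsto_zero]
  refine squeeze_zero (fun _ => norm_nonneg _) (fun n => ?_) tendsto_one_div_add_atTop_nhds_zero_nat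
  rw [norm_sub_rev]
  exact hTn n

end CompactForm

/-! ### Existence of eigenvectors by minimisation, and the upper min-max bound. -/

namespace CompactForm

open Filter Topology
open scoped InnerProductSpace

variable {E X : Type*} [NormedAddCommGroup E] [InnerProductSpace ℝ E]
  [NormedAddCommGroup X] [InnerProductSpace ℝ X] {J : E →L[ℝ] X} {M : X →L[ℝ] X}

/-- A Gårding inequality: it makes the form bounded below on the sphere `‖J u‖ = 1` and keeps
minimising sequences bounded in `E`. -/
lemma norm_sq_le_form (u : E) : ‖u‖ ^ 2 ≤ form J M u u + ‖M‖ * ‖J u‖ ^ 2 := by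
  have h1 : |⟪M (J u), J u⟫_ℝ| ≤ ‖M‖ * ‖J u‖ ^ 2 := by
    refine (abs_real_inner_le_norm _ _).trans ?_
    have := M.le_opNorm (J u)
    nlinarith [norm_nonneg (J u)]
  rw [form_apply, real_inner_self_eq_norm_sq]
  linarith [neg_abs_le ⟪M (J u), J u⟫_ℝ]

lemma form_add_smul (hM : ∀ x y, ⟪M x, y⟫_ℝ = ⟪x, M y⟫_ℝ) (u v : E) (s : ℝ) :
    form J M (u + s • v) (u + s • v) =
      form J M u u + 2 * s * form J M u v + s ^ 2 * form J M v v := by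
  simp only [map_add, map_smul, LinearMap.add_apply, LinearMap.smul_apply, smul_eq_mul,
    form_comm hM v u]
  ring

lemma norm_add_smul_sq (x y : X) (s : ℝ) :
    ‖x + s • y‖ ^ 2 = ‖x‖ ^ 2 + 2 * s * ⟪x, y⟫_ℝ + s ^ 2 * ‖y‖ ^ 2 := by
  rw [norm_add_sq_real, inner_smul_right, norm_smul, mul_pow, Real.norm_eq_abs, sq_abs]
  ring

/-- The form attains its minimum on the unit sphere of a `J`-orthogonal complement. -/
lemma exists_minimizer [CompleteSpace E] (hJ : IsCompactOperator J) {ι : Type*} (x : ι → X)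
    {w : E} {t : ℝ} (hw0 : J w ≠ 0) (hwx : ∀ j, ⟪x j, J w⟫_ℝ = 0)
    (hwt : form J M w w ≤ t * ‖J w‖ ^ 2) :
    ∃ (u : E) (μ : ℝ), ‖J u‖ = 1 ∧ (∀ j, ⟪x j, J u⟫_ℝ = 0) ∧ form J M u u = μ ∧ μ ≤ t ∧
      ∀ v, (∀ j, ⟪x j, J v⟫_ℝ = 0) → μ * ‖J v‖ ^ 2 ≤ form J M v v := by
  set A : Set ℝ := {a | ∃ u : E, ‖J u‖ = 1 ∧ (∀ j, ⟪x j, J u⟫_ℝ = 0) ∧ form J M u u = a} with hA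
  have hnorm : ∀ v : E, J v ≠ 0 → (∀ j, ⟪x j, J v⟫_ℝ = 0) →
      form J M v v / ‖J v‖ ^ 2 ∈ A := by
    intro v hv0 hv
    have h0 : ‖J v‖ ≠ 0 := norm_ne_zero_iff.2 hv0
    refine ⟨‖J v‖⁻¹ • v, ?_, fun j => ?_, ?_⟩
    · rw [map_smul, norm_smul, norm_inv, norm_norm, inv_mul_cancel₀ h0]
    · rw [map_smul, inner_smul_right, hv j, mul_zero]
    · simp only [map_smul, LinearMap.smul_apply, smul_eq_mul]
      field_simp
  have hbdd : BddBelow A := by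
    refine ⟨-‖M‖, ?_⟩
    rintro a ⟨u, hu1, -, rfl⟩
    have := norm_sq_le_form (J := J) (M := M) u
    rw [hu1] at this
    nlinarith [sq_nonneg ‖u‖]
  have hne : A.Nonempty := ⟨_, hnorm w hw0 hwx⟩
  set μ := sInf A with hμ
  have hmin : ∀ v, (∀ j, ⟪x j, J v⟫_ℝ = 0) → μ * ‖J v‖ ^ 2 ≤ form J M v v := by
    intro v hv
    by_cases hv0 : J v = 0
    · rw [form_apply, hv0]
      simp
    · have h0 : 0 < ‖J v‖ ^ 2 := by positivity
      rw [← le_div_iff₀ h0]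
      exact csInf_le hbdd (hnorm v hv0 hv)
  obtain ⟨a, ha_anti, ha_tendsto, haA⟩ := exists_seq_tendsto_sInf hne hbdd
  choose u hu1 hux hua using haA
  obtain ⟨K, hK, hKu⟩ := hJ.image_closedBall_subset_compact √(a 0 + ‖M‖)
  have huK : ∀ n, J (u n) ∈ K := by
    intro n
    refine hKu ⟨u n, ?_, rfl⟩
    rw [mem_closedBall_zero_iff]
    refine Real.le_sqrt_of_sq_le ?_
    have := norm_sq_le_form (J := J) (M := M) (u n)
    rw [hu1, hua] at this
    linarith [ha_anti (Nat.zero_le n)]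
  obtain ⟨y, -, φ, hφ, hφy⟩ := hK.tendsto_subseq huK
  have haφ : Tendsto (fun n => a (φ n)) atTop (𝓝 μ) := ha_tendsto.comp hφ.tendsto_atTop
  -- Parallelogram law for the form and for `‖J ·‖²`, with minimality applied to `u m + u n`.
  -- Convergence of `J (u n)` along a subsequence thereby upgrades to strong convergence in `E`.
  have hest : ∀ m n, ‖u m - u n‖ ^ 2 ≤
      2 * (a m - μ) + 2 * (a n - μ) + (|μ| + ‖M‖) * ‖J (u m) - J (u n)‖ ^ 2 := by
    intro m n
    have h1 := norm_sq_le_form (J := J) (M := M) (u m - u n)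
    have h2 := hmin (u m + u n) (fun j => by rw [map_add, inner_add_right, hux, hux, add_zero])
    have h3 : form J M (u m - u n) (u m - u n) = 2 * a m + 2 * a n
        - form J M (u m + u n) (u m + u n) := by
      simp only [map_add, map_sub, LinearMap.add_apply, LinearMap.sub_apply, hua]
      ring
    have h4 := parallelogram_law_with_norm ℝ (J (u m)) (J (u n))
    rw [hu1, hu1] at h4
    rw [map_add] at h2
    rw [h3, map_sub] at h1
    have h5 : μ * ‖J (u m) - J (u n)‖ ^ 2 ≤ |μ| * ‖J (u m) - J (u n)‖ ^ 2 :=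
      mul_le_mul_of_nonneg_right (le_abs_self μ) (sq_nonneg _)
    have h6 : ‖J (u m) + J (u n)‖ ^ 2 = 4 - ‖J (u m) - J (u n)‖ ^ 2 := by linarith
    rw [h6] at h2
    linarith
  have hcauchy : CauchySeq (fun n => u (φ n)) := by
    rw [cauchySeq_iff_tendsto_dist_atTop_0]
    have h1 : Tendsto (fun p : ℕ × ℕ => dist (J (u (φ p.1))) (J (u (φ p.2)))) atTop (𝓝 0) :=
      cauchySeq_iff_tendsto_dist_atTop_0.1 hφy.cauchySeq
    have h2 : Tendsto (fun p : ℕ × ℕ => a (φ p.1)) atTop (𝓝 μ) := by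
      rw [← prod_atTop_atTop_eq]; exact haφ.comp tendsto_fst
    have h3 : Tendsto (fun p : ℕ × ℕ => a (φ p.2)) atTop (𝓝 μ) := by
      rw [← prod_atTop_atTop_eq]; exact haφ.comp tendsto_snd
    have h4 := ((((h2.sub_const μ).const_mul 2).add ((h3.sub_const μ).const_mul 2)).add
      ((h1.pow 2).const_mul (|μ| + ‖M‖))).sqrt
    simp only [sub_self, mul_zero, add_zero, ne_eq, OfNat.ofNat_ne_zero, not_false_eq_true,
      zero_pow, Real.sqrt_zero] at h4
    refine squeeze_zero (fun _ => dist_nonneg) (fun p => ?_) h4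
    refine Real.le_sqrt_of_sq_le ?_
    rw [dist_eq_norm, dist_eq_norm]
    exact hest _ _
  obtain ⟨v, hv⟩ := cauchySeq_tendsto_of_complete hcauchy
  have hJv : Tendsto (fun n => J (u (φ n))) atTop (𝓝 (J v)) := (J.continuous.tendsto v).comp hv
  refine ⟨v, μ, ?_, fun j => ?_, ?_, ?_, hmin⟩
  · refine tendsto_nhds_unique hJv.norm ?_
    simp only [hu1]
    exact tendsto_const_nhds
  · refine tendsto_nhds_unique ((tendsto_const_nhds (x := x j)).inner hJv) ?_
    simp only [hux]
    exact tendsto_const_nhds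
  · have h1 : Tendsto (fun n => form J M (u (φ n)) (u (φ n))) atTop (𝓝 (form J M v v)) := by
      simp only [form_apply]
      exact (hv.inner hv).add (((M.continuous.tendsto _).comp hJv).inner hJv)
    refine tendsto_nhds_unique h1 ?_
    simp only [hua]
    exact haφ
  · refine (csInf_le hbdd (hnorm w hw0 hwx)).trans ?_
    have h0 : 0 < ‖J w‖ ^ 2 := by positivity
    rwa [div_le_iff₀ h0]

/-- The minimiser on the complement of the known eigenvectors satisfies the weak equation against
test vectors in that complement. It extends to all test vectors because both sides vanish on the
known eigenvectors, by symmetry of the form. -/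
lemma exists_isEigenvector [CompleteSpace E] (hJ : IsCompactOperator J)
    (hM : ∀ x y, ⟪M x, y⟫_ℝ = ⟪x, M y⟫_ℝ) {ι : Type*} [Fintype ι] {x : ι → X} {e : ι → ℝ}
    (hx : ∀ j, IsEigenvector J M (x j) (e j)) (horth : ∀ i j, i ≠ j → ⟪x i, x j⟫_ℝ = 0)
    {w : E} {t : ℝ} (hw0 : J w ≠ 0) (hwx : ∀ j, ⟪x j, J w⟫_ℝ = 0)
    (hwt : form J M w w ≤ t * ‖J w‖ ^ 2) :
    ∃ (y : X) (μ : ℝ), IsEigenvector J M y μ ∧ μ ≤ t ∧ ∀ j, ⟪x j, y⟫_ℝ = 0 := by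
  obtain ⟨u, μ, hu1, hux, huμ, hμt, hmin⟩ := exists_minimizer hJ x hw0 hwx hwt
  have hvar : ∀ v, (∀ j, ⟪x j, J v⟫_ℝ = 0) → form J M u v = μ * ⟪J u, J v⟫_ℝ := by
    intro v hv
    -- First variation: a quadratic in `s` that is nonnegative with zero constant term has zero
    -- linear coefficient, read off from its discriminant.
    have h1 : ∀ s : ℝ, 0 ≤ (form J M v v - μ * ‖J v‖ ^ 2) * (s * s)
        + (2 * (form J M u v - μ * ⟪J u, J v⟫_ℝ)) * s + 0 := by
      intro s
      have h2 := hmin (u + s • v) (fun j => by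
        rw [map_add, map_smul, inner_add_right, inner_smul_right, hux, hv]; ring)
      rw [form_add_smul hM, map_add, map_smul, norm_add_smul_sq, hu1, huμ] at h2
      nlinarith
    have h3 := discrim_le_zero h1
    rw [discrim] at h3
    nlinarith [sq_nonneg (form J M u v - μ * ⟪J u, J v⟫_ℝ)]
  refine ⟨J u, μ, ⟨fun h => by simp [h] at hu1, u, rfl, fun v => ?_⟩, hμt, hux⟩
  choose hx0 z hz hzv using hx
  classical
  -- Orthogonal projection off the `x j`, carried out in `E` by means of the preimages `z j`.
  set v' : E := v - ∑ j, (⟪x j, J v⟫_ℝ / ‖x j‖ ^ 2) • z j with hv'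
  have h1 := hvar v' (fun j => by
    rw [hv', map_sub, map_sum, inner_sub_right, inner_sum, Finset.sum_eq_single j]
    · rw [map_smul, inner_smul_right, hz, real_inner_self_eq_norm_sq]
      have : ‖x j‖ ≠ 0 := norm_ne_zero_iff.2 (hx0 j)
      field_simp
      ring
    · intro i _ hij
      rw [map_smul, inner_smul_right, hz, horth j i hij.symm, mul_zero]
    · simp)
  have h2 : ∀ j, form J M u (z j) = 0 := fun j => by
    rw [form_comm hM, hzv, hux, mul_zero]
  have h3 : ∀ j, ⟪J u, x j⟫_ℝ = 0 := fun j => by rw [real_inner_comm, hux]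
  rw [hv'] at h1
  simpa [map_sub, map_sum, map_smul, inner_sub_right, inner_sum, inner_smul_right, h2, hz, h3]
    using h1

/-- A test space of dimension `k` on which the form is at most `t ‖·‖²` shows that `t` is a level
of order `k`. -/
lemma mem_levels [CompleteSpace E] (hJ : IsCompactOperator J)
    (hM : ∀ x y, ⟪M x, y⟫_ℝ = ⟪x, M y⟫_ℝ) {ι : Type*} [Fintype ι] (u : ι → E)
    (hlin : LinearIndependent ℝ fun i => J (u i)) {t : ℝ}
    (ht : ∀ c : ι → ℝ, form J M (∑ i, c i • u i) (∑ i, c i • u i) ≤ t * ‖J (∑ i, c i • u i)‖ ^ 2) :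
    t ∈ levels J M (Fintype.card ι) := by
  -- Orthogonal eigenvectors are produced one at a time. While `r` is below the dimension of the
  -- test space, some nonzero test vector is orthogonal to the `r` found so far and keeps the next
  -- minimum at most `t`.
  have key : ∀ r ≤ Fintype.card ι, ∃ (x : Fin r → X) (e : Fin r → ℝ),
      (∀ i j, i ≠ j → ⟪x i, x j⟫_ℝ = 0) ∧ ∀ j, IsEigenvector J M (x j) (e j) ∧ e j ≤ t := by
    intro r
    induction r with
    | zero => exact fun _ => ⟨Fin.elim0, Fin.elim0, fun i => i.elim0, fun i => i.elim0⟩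
    | succ r ih =>
      intro hr
      obtain ⟨x, e, horth, hx⟩ := ih (by omega)
      let L : (ι → ℝ) →ₗ[ℝ] (Fin r → ℝ) :=
        { toFun := fun c j => ∑ i, c i * ⟪x j, J (u i)⟫_ℝ
          map_add' := fun a b => by ext i; simp [add_mul, Finset.sum_add_distrib]
          map_smul' := fun r a => by ext i; simp [mul_assoc, Finset.mul_sum] }
      obtain ⟨c, hcL, hc0⟩ : ∃ c, L c = 0 ∧ c ≠ 0 := by
        have : LinearMap.ker L ≠ ⊥ :=
          LinearMap.ker_ne_bot_of_finrank_lt (by simpa using Nat.lt_of_succ_le hr)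
        obtain ⟨c, hc, hc0⟩ := (Submodule.ne_bot_iff _).1 this
        exact ⟨c, hc, hc0⟩
      have hJ' : J (∑ i, c i • u i) = ∑ i, c i • J (u i) := by simp
      obtain ⟨y, μ, hy, hμ, hxy⟩ := exists_isEigenvector hJ hM (fun j => (hx j).1) horth
        (w := ∑ i, c i • u i) (t := t) (fun h => hc0 (funext
          (Fintype.linearIndependent_iff.1 hlin c (hJ' ▸ h))))
        (fun j => by
          have := congrFun hcL j
          simp only [L, LinearMap.coe_mk, AddHom.coe_mk, Pi.zero_apply] at this
          rw [hJ', inner_sum]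
          simpa [inner_smul_right] using this) (ht c)
      refine ⟨Fin.cons y x, Fin.cons μ e, fun i j => ?_, fun j => ?_⟩
      · refine Fin.cases ?_ (fun i => ?_) i <;> refine Fin.cases ?_ (fun j => ?_) j
        · simp
        · intro _; simpa [real_inner_comm] using hxy j
        · intro _; simpa using hxy i
        · intro hij
          simpa using horth i j (fun h => hij (by rw [h]))
      · refine Fin.cases ?_ (fun j => ?_) j
        · simpa using ⟨hy, hμ⟩
        · simpa using hx j
  obtain ⟨x, e, horth, hx⟩ := key _ le_rfl
  exact ⟨x, e, linearIndependent_of_ne_zero_of_inner_eq_zero (fun j => (hx j).1.1)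
    (fun i j hij => horth i j hij), hx⟩

/-- If the form dominates arbitrarily large multiples of `‖·‖²` under finitely many constraints, the
infimum of a nonempty set of levels of positive order is attained. -/
lemma isLeast_levels (hM : ∀ x y, ⟪M x, y⟫_ℝ = ⟪x, M y⟫_ℝ)
    (hc : ∀ T : ℝ, ∃ s : Finset X, ∀ u : E, (∀ x ∈ s, ⟪x, J u⟫_ℝ = 0) →
      T * ‖J u‖ ^ 2 ≤ form J M u u) {k : ℕ} (hk : 1 ≤ k) (hne : (levels J M k).Nonempty) :
    IsLeast (levels J M k) (sInf (levels J M k)) := by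
  obtain ⟨t₀, ht₀⟩ := hne
  set Λ : Set ℝ := {e | e ≤ t₀ ∧ ∃ x, IsEigenvector J M x e} with hΛ
  -- Distinct eigenvalues have orthogonal eigenvectors. Infinitely many below `t₀` would outnumber
  -- the constraints that force the form above `(t₀ + 1) ‖·‖²`.
  have hfin : Λ.Finite := by
    by_contra hinf
    obtain ⟨s, hs⟩ := hc (t₀ + 1)
    obtain ⟨S, hSΛ, hS⟩ := Set.Infinite.exists_subset_card_eq hinf (s.card + 1)
    let e : Fin (s.card + 1) ≃ S := (S.equivFinOfCardEq hS).symm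
    have hmem : ∀ j, (e j : ℝ) ∈ Λ := fun j => hSΛ (e j).2
    choose hle x hx using hmem
    have h1 : t₀ ∈ levels J M (s.card + 1) := by
      refine ⟨x, fun j => e j, linearIndependent_of_ne_zero_of_inner_eq_zero
        (fun j => (hx j).1) (fun i j hij => ?_), fun j => ⟨hx j, hle j⟩⟩
      exact (hx i).inner_eq_zero hM (hx j) (fun h => hij (e.injective (Subtype.ext h)))
    have h2 := le_of_mem_levels hM h1 (ι := s) (by simp) (fun i => (i : X))
      (t₀ := t₀ + 1) (fun u hu => hs u fun x hx => hu ⟨x, hx⟩)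
    linarith
  -- A level can be lowered to the largest eigenvalue among its own witnesses, which exists since `1
  -- ≤ k`. Only the finitely many elements of `Λ` then compete for the minimum.
  have hstep : ∀ t ∈ levels J M k, t ≤ t₀ → ∃ t' ∈ levels J M k ∩ Λ, t' ≤ t := by
    rintro t ⟨x, e, hlin, hx⟩ htt
    have : Nonempty (Fin k) := ⟨⟨0, hk⟩⟩
    obtain ⟨j₀, hj₀⟩ := Finite.exists_max e
    exact ⟨e j₀, ⟨⟨x, e, hlin, fun j => ⟨(hx j).1, hj₀ j⟩⟩, (hx j₀).2.trans htt, x j₀, (hx j₀).1⟩,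
      (hx j₀).2⟩
  obtain ⟨t₁, ht₁, -⟩ := hstep t₀ ht₀ le_rfl
  obtain ⟨m, hm, hmin⟩ := Set.exists_min_image _ id (hfin.subset (Set.inter_subset_right
    (s := levels J M k))) ⟨t₁, ht₁⟩
  have hleast : IsLeast (levels J M k) m := by
    refine ⟨hm.1, fun t ht => ?_⟩
    rcases le_total t t₀ with h | h
    · obtain ⟨t', ht', h'⟩ := hstep t ht h
      exact (hmin t' ht').trans h'
    · exact hm.2.1.trans h
  rwa [hleast.csInf_eq]

end CompactForm

/-! ### The periodic Sobolev space -/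

namespace SchroedingerPer

open scoped InnerProductSpace ENNReal

variable {d : ℕ}

lemma unitCube_subset_Icc : unitCube d ⊆ Set.Icc 0 1 := fun _ hx =>
  ⟨fun i => (hx i trivial).1.le, fun i => (hx i trivial).2.le⟩

lemma isOpen_unitCube : IsOpen (unitCube d) :=
  isOpen_set_pi Set.finite_univ fun _ _ => isOpen_Ioo

lemma measurableSet_unitCube : MeasurableSet (unitCube d) := isOpen_unitCube.measurableSet

instance isProbabilityMeasure_unitCube :
    IsProbabilityMeasure ((volume : Measure (Fin d → ℝ)).restrict (unitCube d)) :=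
  ⟨by rw [Measure.restrict_apply_univ, unitCube, Real.volume_pi_Ioo]; simp⟩

lemma memLp_of_continuous {f : (Fin d → ℝ) → ℝ} (hf : Continuous f) (p : ℝ≥0∞) :
    MemLp f p ((volume : Measure (Fin d → ℝ)).restrict (unitCube d)) := by
  obtain ⟨C, hC⟩ := (isCompact_Icc (a := (0 : Fin d → ℝ)) (b := 1)).exists_bound_of_continuousOn
    hf.continuousOn
  refine MemLp.of_bound hf.aestronglyMeasurable C ?_
  exact ae_restrict_of_forall_mem measurableSet_unitCube fun x hx => hC x (unitCube_subset_Icc hx)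

/-- The class in `L²(D)` of a continuous function. -/
noncomputable def toL2 (f : (Fin d → ℝ) → ℝ) (hf : Continuous f) : L2D d :=
  (memLp_of_continuous hf 2).toLp f

lemma coeFn_toL2 (f : (Fin d → ℝ) → ℝ) (hf : Continuous f) :
    toL2 f hf =ᵐ[volume.restrict (unitCube d)] f := MemLp.coeFn_toLp _

lemma inner_L2D (u v : L2D d) : ⟪u, v⟫_ℝ = ∫ x in unitCube d, u x * v x := by
  rw [L2.inner_def]
  simp [mul_comm]

lemma integrable_mul_L2D (u v : L2D d) :
    Integrable (fun x => u x * v x) (volume.restrict (unitCube d)) :=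
  (Lp.memLp u).integrable_mul (Lp.memLp v)

lemma norm_sq_L2D (u : L2D d) : ‖u‖ ^ 2 = ∫ x in unitCube d, u x ^ 2 := by
  rw [← real_inner_self_eq_norm_sq, inner_L2D]
  simp only [pow_two]

/-- Multiplication by a bounded function on `L²(D)`. -/
noncomputable def mulOp (w : (Fin d → ℝ) → ℝ)
    (hw : MemLp w ∞ ((volume : Measure (Fin d → ℝ)).restrict (unitCube d))) : L2D d →L[ℝ] L2D d :=
  (ContinuousLinearMap.mul ℝ ℝ).holderL _ ∞ 2 2 (hw.toLp w)

variable {w : (Fin d → ℝ) → ℝ}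
  (hw : MemLp w ∞ ((volume : Measure (Fin d → ℝ)).restrict (unitCube d)))

lemma coeFn_mulOp (u : L2D d) :
    mulOp w hw u =ᵐ[volume.restrict (unitCube d)] fun x => w x * u x := by
  have h1 := (ContinuousLinearMap.mul ℝ ℝ).coeFn_holder (r := 2) (hw.toLp w) u
  filter_upwards [h1, hw.coeFn_toLp] with x hx hx2
  refine Eq.trans hx ?_
  rw [hx2]; rfl

lemma inner_mulOp_left (u v : L2D d) :
    ⟪mulOp w hw u, v⟫_ℝ = ∫ x in unitCube d, w x * u x * v x := by
  rw [inner_L2D]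
  refine integral_congr_ae ?_
  filter_upwards [coeFn_mulOp hw u] with x hx
  rw [hx]

lemma inner_mulOp_right (u v : L2D d) :
    ⟪u, mulOp w hw v⟫_ℝ = ∫ x in unitCube d, w x * u x * v x := by
  rw [real_inner_comm, inner_mulOp_left]
  exact integral_congr_ae (Filter.Eventually.of_forall fun x => by ring)

lemma integrable_mul_mul_L2D {w : (Fin d → ℝ) → ℝ}
    (hw : MemLp w ∞ ((volume : Measure (Fin d → ℝ)).restrict (unitCube d))) (u v : L2D d) :
    Integrable (fun x => w x * u x * v x) (volume.restrict (unitCube d)) := by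
  refine (integrable_mul_L2D (mulOp w hw u) v).congr ?_
  filter_upwards [coeFn_mulOp hw u] with x hx
  rw [hx]

lemma IsPeriodicTest.continuous {φ : (Fin d → ℝ) → ℝ} (hφ : IsPeriodicTest φ) : Continuous φ :=
  hφ.1.continuous

lemma IsPeriodicTest.continuous_fderiv {φ : (Fin d → ℝ) → ℝ} (hφ : IsPeriodicTest φ)
    (v : Fin d → ℝ) : Continuous fun x => fderiv ℝ φ x v :=
  (hφ.1.continuous_fderiv (by simp)).clm_apply continuous_const

/-- Each test function gives a continuous linear equation in `(u, g)`. This is what makes `H1per` a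
closed subspace, hence complete. -/
lemma isPeriodicWeakGradient_iff {u : L2D d} {g : Fin d → L2D d} :
    IsPeriodicWeakGradient u g ↔ ∀ (φ : (Fin d → ℝ) → ℝ) (hφ : IsPeriodicTest φ) (i : Fin d),
      ⟪u, toL2 _ (hφ.continuous_fderiv (Pi.single i 1))⟫_ℝ + ⟪g i, toL2 φ hφ.continuous⟫_ℝ = 0 := by
  refine forall₃_congr fun φ hφ i => ?_
  rw [← eq_neg_iff_add_eq_zero, inner_L2D, inner_L2D]
  have h1 : ∫ x in unitCube d, u x * toL2 _ (hφ.continuous_fderiv (Pi.single i 1)) x =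
      ∫ x in unitCube d, u x * fderiv ℝ φ x (Pi.single i 1) := by
    refine integral_congr_ae ?_
    filter_upwards [coeFn_toL2 _ (hφ.continuous_fderiv (Pi.single i 1))] with x hx
    rw [hx]
  have h2 : ∫ x in unitCube d, g i x * toL2 φ hφ.continuous x =
      ∫ x in unitCube d, g i x * φ x := by
    refine integral_congr_ae ?_
    filter_upwards [coeFn_toL2 φ hφ.continuous] with x hx
    rw [hx]
  rw [h1, h2]

/-- The space `H¹_per(D)`, as the space of pairs of a function and a weak gradient. -/
noncomputable def H1per (d : ℕ) : Submodule ℝ (PiLp 2 fun _ : Option (Fin d) => L2D d) where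
  carrier := {p | IsPeriodicWeakGradient (p none) fun i => p (some i)}
  zero_mem' := by
    simp only [Set.mem_ofPred_eq, isPeriodicWeakGradient_iff]
    intro φ hφ i; simp
  add_mem' := by
    simp only [Set.mem_ofPred_eq, isPeriodicWeakGradient_iff]
    intro a b ha hb φ hφ i
    have h1 := ha φ hφ i
    have h2 := hb φ hφ i
    simp only [PiLp.add_apply, inner_add_left]
    linarith
  smul_mem' := by
    simp only [Set.mem_ofPred_eq, isPeriodicWeakGradient_iff]
    intro c a ha φ hφ i
    have h1 := ha φ hφ i
    simp only [PiLp.smul_apply, inner_smul_left]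
    rw [← mul_add, h1, mul_zero]

lemma mem_H1per {p : PiLp 2 fun _ : Option (Fin d) => L2D d} :
    p ∈ H1per d ↔ IsPeriodicWeakGradient (p none) fun i => p (some i) := Iff.rfl

lemma isClosed_H1per : IsClosed (H1per d : Set (PiLp 2 fun _ : Option (Fin d) => L2D d)) := by
  have : (H1per d : Set (PiLp 2 fun _ : Option (Fin d) => L2D d)) =
      ⋂ (φ : (Fin d → ℝ) → ℝ) (hφ : IsPeriodicTest φ) (i : Fin d),
        {p | ⟪p none, toL2 _ (hφ.continuous_fderiv (Pi.single i 1))⟫_ℝ +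
          ⟪p (some i), toL2 φ hφ.continuous⟫_ℝ = 0} := by
    ext p
    simp only [SetLike.mem_coe, mem_H1per, isPeriodicWeakGradient_iff, Set.mem_iInter,
      Set.mem_ofPred_eq]
  rw [this]
  refine isClosed_iInter fun φ => isClosed_iInter fun hφ => isClosed_iInter fun i =>
    isClosed_eq ?_ continuous_const
  exact ((PiLp.continuous_apply 2 _ none).inner continuous_const).add
    ((PiLp.continuous_apply 2 _ (some i)).inner continuous_const)

instance : CompleteSpace (H1per d) := isClosed_H1per.completeSpace_coe

/-- The pair of a function and a weak gradient as an element of `H¹_per(D)`. -/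
noncomputable def H1per.mk (u : L2D d) (g : Fin d → L2D d) (h : IsPeriodicWeakGradient u g) :
    H1per d :=
  ⟨WithLp.toLp 2 fun o => o.elim u g, h⟩

/-- The components of the weak gradient. -/
noncomputable def H1per.grad (p : H1per d) (i : Fin d) : L2D d := (p : PiLp 2 fun _ : Option (Fin d) => L2D d) (some i)

/-- The embedding of `H¹_per(D)` into `L²(D)`. -/
noncomputable def H1per.embed : H1per d →L[ℝ] L2D d :=
  (PiLp.proj 2 (fun _ : Option (Fin d) => L2D d) none).comp (H1per d).subtypeL

lemma H1per.isPeriodicWeakGradient (p : H1per d) :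
    IsPeriodicWeakGradient (embed p) (grad p) := p.2

@[simp] lemma H1per.embed_mk (u : L2D d) (g : Fin d → L2D d) (h : IsPeriodicWeakGradient u g) :
    embed (mk u g h) = u := rfl

@[simp] lemma H1per.grad_mk (u : L2D d) (g : Fin d → L2D d) (h : IsPeriodicWeakGradient u g) :
    grad (mk u g h) = g := rfl

lemma H1per.inner_eq (p q : H1per d) :
    ⟪p, q⟫_ℝ = ⟪embed p, embed q⟫_ℝ + ∑ i, ⟪grad p i, grad q i⟫_ℝ := by
  rw [Submodule.coe_inner, PiLp.inner_apply, Fintype.sum_option]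
  rfl

lemma H1per.norm_sq_eq (p : H1per d) : ‖p‖ ^ 2 = ‖embed p‖ ^ 2 + ∑ i, ‖grad p i‖ ^ 2 := by
  simp only [← real_inner_self_eq_norm_sq, H1per.inner_eq]

open CompactForm

/-- The form of `-Δ + V`, in the shape of an `H¹` inner product plus a bounded perturbation. -/
lemma form_H1per {V : (Fin d → ℝ) → ℝ} (hV : MemLp V ∞ (volume.restrict (unitCube d)))
    (p q : H1per d) :
    form H1per.embed (mulOp V hV - 1) p q =
      (∑ i, ⟪H1per.grad p i, H1per.grad q i⟫_ℝ) + ⟪mulOp V hV (H1per.embed p), H1per.embed q⟫_ℝ := by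
  rw [form_apply, H1per.inner_eq, sub_apply, inner_sub_left]
  simp only [one_apply_eq_self]
  ring

lemma mulOp_sub_one_symm {V : (Fin d → ℝ) → ℝ} (hV : MemLp V ∞ (volume.restrict (unitCube d)))
    (x y : L2D d) : ⟪(mulOp V hV - 1) x, y⟫_ℝ = ⟪x, (mulOp V hV - 1) y⟫_ℝ := by
  simp only [sub_apply, inner_sub_left, inner_sub_right, inner_mulOp_left,
    inner_mulOp_right, one_apply_eq_self]

/-- The bridge to the abstract theory. The `-1` in `mulOp V hV - 1` removes the `L²` part of the
`H¹` inner product, leaving exactly the Schrödinger form. -/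
lemma isEigenpair_iff {V : (Fin d → ℝ) → ℝ} (hV : MemLp V ∞ (volume.restrict (unitCube d)))
    (u : L2D d) (e : ℝ) :
    IsEigenpair V u e ↔ IsEigenvector H1per.embed (mulOp V hV - 1) u e := by
  have key : ∀ p q : H1per d,
      ∫ x in unitCube d, ((∑ i, H1per.grad p i x * H1per.grad q i x) + V x * H1per.embed p x * H1per.embed q x) =
        form H1per.embed (mulOp V hV - 1) p q := by
    intro p q
    rw [integral_add (integrable_finsetSum _ fun i _ => integrable_mul_L2D _ _)
      (integrable_mul_mul_L2D hV _ _), integral_finsetSum _ fun i _ => integrable_mul_L2D _ _,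
      form_H1per, inner_mulOp_left]
    simp only [inner_L2D]
  refine and_congr_right fun _ => ⟨?_, ?_⟩
  · rintro ⟨g, hg, h⟩
    refine ⟨H1per.mk u g hg, rfl, fun v => ?_⟩
    rw [← key, inner_L2D]
    exact h _ _ (H1per.isPeriodicWeakGradient v)
  · rintro ⟨p, rfl, h⟩
    refine ⟨H1per.grad p, H1per.isPeriodicWeakGradient p, fun v gv hgv => ?_⟩
    have := h (H1per.mk v gv hgv)
    rwa [← key, inner_L2D] at this

lemma levelsAbove_eq {V : (Fin d → ℝ) → ℝ} (hV : MemLp V ∞ (volume.restrict (unitCube d)))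
    (k : ℕ) : levelsAbove V k = levels H1per.embed (mulOp V hV - 1) k := by
  ext t
  simp only [levelsAbove, levels, isEigenpair_iff hV]

end SchroedingerPer

/-! ### Density of smooth periodic functions -/

namespace SchroedingerPer

open scoped InnerProductSpace ENNReal Real
open Filter Topology

attribute [local instance] instMeasureSpaceUnitAddCircle

variable {d : ℕ}

/-- The phase `2 π k · x`, as a linear functional of `x`. -/
noncomputable def phase (k : Fin d → ℤ) : (Fin d → ℝ) →L[ℝ] ℝ :=
  ∑ i, (2 * π * (k i : ℝ)) • ContinuousLinearMap.proj i

lemma phase_apply (k : Fin d → ℤ) (x : Fin d → ℝ) : phase k x = ∑ i, 2 * π * (k i : ℝ) * x i := by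
  simp [phase]

lemma phase_single (k : Fin d → ℤ) (i : Fin d) : phase k (Pi.single i 1) = 2 * π * (k i : ℝ) := by
  rw [phase_apply, Finset.sum_eq_single i] <;> simp +contextual

lemma phase_intCast (k z : Fin d → ℤ) :
    phase k (fun i => (z i : ℝ)) = (∑ i, k i * z i : ℤ) * (2 * π) := by
  rw [phase_apply]
  push_cast
  rw [Finset.sum_mul]
  exact Finset.sum_congr rfl fun i _ => by ring

lemma isPeriodicTest_cos (k : Fin d → ℤ) : IsPeriodicTest fun x => Real.cos (phase k x) :=
  ⟨Real.contDiff_cos.comp (phase k).contDiff, fun x z => by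
    simp only
    rw [map_add, phase_intCast, Real.cos_add_int_mul_two_pi]⟩

lemma isPeriodicTest_sin (k : Fin d → ℤ) : IsPeriodicTest fun x => Real.sin (phase k x) :=
  ⟨Real.contDiff_sin.comp (phase k).contDiff, fun x z => by
    simp only
    rw [map_add, phase_intCast, Real.sin_add_int_mul_two_pi]⟩

lemma fderiv_cos_phase (k : Fin d → ℤ) (i : Fin d) (x : Fin d → ℝ) :
    fderiv ℝ (fun x => Real.cos (phase k x)) x (Pi.single i 1) =
      -(2 * π * (k i : ℝ)) * Real.sin (phase k x) := by
  rw [((phase k).hasFDerivAt.cos (x := x)).fderiv]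
  simp [phase_single]; ring

lemma fderiv_sin_phase (k : Fin d → ℤ) (i : Fin d) (x : Fin d → ℝ) :
    fderiv ℝ (fun x => Real.sin (phase k x)) x (Pi.single i 1) =
      (2 * π * (k i : ℝ)) * Real.cos (phase k x) := by
  rw [((phase k).hasFDerivAt.sin (x := x)).fderiv]
  simp [phase_single]; ring

/-- The Fourier cosine coefficient, up to normalisation. -/
noncomputable def cosCoeff (f : L2D d) (k : Fin d → ℤ) : ℝ :=
  ∫ x in unitCube d, f x * Real.cos (phase k x)

/-- The Fourier sine coefficient, up to normalisation. -/
noncomputable def sinCoeff (f : L2D d) (k : Fin d → ℤ) : ℝ :=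
  ∫ x in unitCube d, f x * Real.sin (phase k x)

/-- Partial sums of the Fourier series. -/
noncomputable def fourierSum (f : L2D d) (F : Finset (Fin d → ℤ)) (x : Fin d → ℝ) : ℝ :=
  ∑ k ∈ F, (cosCoeff f k * Real.cos (phase k x) + sinCoeff f k * Real.sin (phase k x))

lemma isPeriodicTest_fourierSum (f : L2D d) (F : Finset (Fin d → ℤ)) :
    IsPeriodicTest (fourierSum f F) := by
  refine ⟨ContDiff.sum fun k _ => ?_, fun x z => ?_⟩
  · exact (contDiff_const.mul (isPeriodicTest_cos k).1).add
      (contDiff_const.mul (isPeriodicTest_sin k).1)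
  · refine Finset.sum_congr rfl fun k _ => ?_
    have h1 := (isPeriodicTest_cos k).2 x z
    have h2 := (isPeriodicTest_sin k).2 x z
    simp only at h1 h2
    rw [h1, h2]

lemma cosCoeff_grad {u : L2D d} {g : Fin d → L2D d} (h : IsPeriodicWeakGradient u g) (i : Fin d)
    (k : Fin d → ℤ) : cosCoeff (g i) k = 2 * π * (k i : ℝ) * sinCoeff u k := by
  have h1 := h _ (isPeriodicTest_cos k) i
  simp only [fderiv_cos_phase] at h1
  rw [cosCoeff, sinCoeff, ← neg_eq_iff_eq_neg.2 h1, ← integral_neg, ← integral_const_mul]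
  exact integral_congr_ae (Eventually.of_forall fun x => by simp only; ring)

lemma sinCoeff_grad {u : L2D d} {g : Fin d → L2D d} (h : IsPeriodicWeakGradient u g) (i : Fin d)
    (k : Fin d → ℤ) : sinCoeff (g i) k = -(2 * π * (k i : ℝ)) * cosCoeff u k := by
  have h1 := h _ (isPeriodicTest_sin k) i
  simp only [fderiv_sin_phase] at h1
  rw [cosCoeff, sinCoeff, ← neg_eq_iff_eq_neg.2 h1, ← integral_neg, ← integral_const_mul]
  exact integral_congr_ae (Eventually.of_forall fun x => by simp only; ring)

/-- Testing the weak gradient against sines and cosines multiplies the coefficients of `u` as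
termwise differentiation does. So truncation commutes with the gradient, and convergence of the
derivatives is `L²` convergence of one more Fourier series. -/
lemma fderiv_fourierSum {u : L2D d} {g : Fin d → L2D d} (h : IsPeriodicWeakGradient u g)
    (F : Finset (Fin d → ℤ)) (i : Fin d) (x : Fin d → ℝ) :
    fderiv ℝ (fourierSum u F) x (Pi.single i 1) = fourierSum (g i) F x := by
  have hc : ∀ k : Fin d → ℤ, DifferentiableAt ℝ (fun x => Real.cos (phase k x)) x := fun k =>
    (isPeriodicTest_cos k).1.differentiable (by simp) x
  have hs : ∀ k : Fin d → ℤ, DifferentiableAt ℝ (fun x => Real.sin (phase k x)) x := fun k =>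
    (isPeriodicTest_sin k).1.differentiable (by simp) x
  have h1 : HasFDerivAt (fourierSum u F) (∑ k ∈ F,
      (cosCoeff u k • fderiv ℝ (fun x => Real.cos (phase k x)) x +
        sinCoeff u k • fderiv ℝ (fun x => Real.sin (phase k x)) x)) x :=
    HasFDerivAt.fun_sum fun k _ => ((hc k).hasFDerivAt.const_mul _).add
      ((hs k).hasFDerivAt.const_mul _)
  rw [h1.fderiv, fourierSum, sum_apply]
  refine Finset.sum_congr rfl fun k _ => ?_
  rw [cosCoeff_grad h, sinCoeff_grad h, add_apply, smul_apply,
    smul_apply, fderiv_cos_phase, fderiv_sin_phase]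
  simp only [smul_eq_mul]
  ring

/-! ### Transfer of Fourier series from the torus to the cube. -/

/-- The fundamental domain section of the torus. -/
noncomputable def torusSection (x : UnitAddTorus (Fin d)) : Fin d → ℝ :=
  (UnitAddTorus.measurableEquivPiIoc (fun _ => (0 : ℝ)) x).1

lemma coe_torusSection (x : UnitAddTorus (Fin d)) :
    (fun i => (torusSection x i : UnitAddCircle)) = x :=
  (UnitAddTorus.measurableEquivPiIoc (fun _ => (0 : ℝ))).symm_apply_apply x

lemma measurePreserving_torusSection : MeasurePreserving (torusSection (d := d)) volume
    (volume.restrict (unitCube d)) := by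
  have h1 := UnitAddTorus.measurePreserving_equivPiIoc (d := Fin d) (a := fun _ => (0 : ℝ))
  have hm : MeasurableSet {x : Fin d → ℝ | ∀ i, x i ∈ Set.Ioc (0 : ℝ) (0 + 1)} :=
    MeasurableSet.univ_pi' fun i => measurableSet_Ioc
  have h2 := measurePreserving_subtype_coe (μa := (volume : Measure (Fin d → ℝ))) hm
  have h3 : (volume : Measure (Fin d → ℝ)).restrict {x | ∀ i, x i ∈ Set.Ioc (0 : ℝ) (0 + 1)} =
      volume.restrict (unitCube d) := by
    refine Measure.restrict_congr_set ?_
    have h4 : {x : Fin d → ℝ | ∀ i, x i ∈ Set.Ioc (0 : ℝ) (0 + 1)} =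
        Set.univ.pi fun _ => Set.Ioc 0 1 := by
      ext x; simp
    rw [h4, unitCube]
    exact (Measure.univ_pi_Ioo_ae_eq_Icc.trans Measure.univ_pi_Ioc_ae_eq_Icc.symm).symm
  rw [h3] at h2
  exact h2.comp h1

lemma mFourier_torusSection (k : Fin d → ℤ) (x : UnitAddTorus (Fin d)) :
    UnitAddTorus.mFourier k x =
      (Real.cos (phase k (torusSection x)) : ℂ) +
        (Real.sin (phase k (torusSection x)) : ℂ) * Complex.I := by
  conv_lhs => rw [← coe_torusSection x]
  rw [Complex.ofReal_cos, Complex.ofReal_sin, ← Complex.exp_mul_I, phase_apply]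
  simp only [UnitAddTorus.mFourier, ContinuousMap.coe_mk, fourier_coe_apply, ← Complex.exp_sum]
  congr 1
  push_cast
  rw [Finset.sum_mul]
  exact Finset.sum_congr rfl fun i _ => by ring

lemma mFourierCoeff_comp_torusSection (f : L2D d) (k : Fin d → ℤ) :
    UnitAddTorus.mFourierCoeff (fun x => (f (torusSection x) : ℂ)) k =
      (cosCoeff f k : ℂ) - (sinCoeff f k : ℂ) * Complex.I := by
  have hf : MemLp f 2 (volume.restrict (unitCube d)) := Lp.memLp f
  have hc : Integrable (fun x => f x * Real.cos (phase k x)) (volume.restrict (unitCube d)) :=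
    hf.integrable_mul (memLp_of_continuous (isPeriodicTest_cos k).continuous 2)
  have hs : Integrable (fun x => f x * Real.sin (phase k x)) (volume.restrict (unitCube d)) :=
    hf.integrable_mul (memLp_of_continuous (isPeriodicTest_sin k).continuous 2)
  have h1 : ∀ x : UnitAddTorus (Fin d), UnitAddTorus.mFourier (-k) x • (f (torusSection x) : ℂ) =
      (fun y => ((f y * Real.cos (phase k y) : ℝ) : ℂ) -
        ((f y * Real.sin (phase k y) : ℝ) : ℂ) * Complex.I) (torusSection x) := by
    intro x
    rw [UnitAddTorus.mFourier_neg, mFourier_torusSection, smul_eq_mul, map_add, map_mul,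
      Complex.conj_ofReal, Complex.conj_ofReal, Complex.conj_I]
    push_cast
    ring
  have hms := (hc.ofReal (𝕜 := ℂ)).sub ((hs.ofReal (𝕜 := ℂ)).mul_const Complex.I)
  rw [UnitAddTorus.mFourierCoeff, integral_congr_ae (Eventually.of_forall h1)]
  have h2 := measurePreserving_torusSection (d := d)
  have h3 : AEStronglyMeasurable (fun y => ((f y * Real.cos (phase k y) : ℝ) : ℂ) -
      ((f y * Real.sin (phase k y) : ℝ) : ℂ) * Complex.I) (Measure.map torusSection volume) := by
    rw [h2.map_eq]
    exact hms.1
  refine (integral_map h2.measurable.aemeasurable h3).symm.trans ?_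
  rw [h2.map_eq]
  rw [integral_sub hc.ofReal (hs.ofReal.mul_const _), integral_mul_const, integral_complex_ofReal,
    integral_complex_ofReal]
  rfl

/-- The error on the cube is the real part of the complex error on the torus, since `(a - i b)(cos +
i sin)` has real part `a cos + b sin`. Hence the finite index set need not be symmetric, and complex
`L²` convergence suffices. -/
lemma tendsto_fourierSum (f : L2D d) :
    Tendsto (fun F => toL2 (fourierSum f F) (isPeriodicTest_fourierSum f F).continuous) atTop
      (𝓝 f) := by
  have hσ := measurePreserving_torusSection (d := d)
  have hf : MemLp (fun x : UnitAddTorus (Fin d) => (f (torusSection x) : ℂ)) 2 volume :=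
    ((Lp.memLp f).comp_measurePreserving hσ).ofReal
  have h1 := UnitAddTorus.hasSum_mFourier_series_L2 (hf.toLp _)
  have hcoeff : ∀ k, UnitAddTorus.mFourierCoeff (hf.toLp _) k =
      (cosCoeff f k : ℂ) - (sinCoeff f k : ℂ) * Complex.I := by
    intro k
    rw [← mFourierCoeff_comp_torusSection, UnitAddTorus.mFourierCoeff,
      UnitAddTorus.mFourierCoeff]
    refine integral_congr_ae ?_
    filter_upwards [hf.coeFn_toLp] with x hx
    rw [hx]
  rw [HasSum, tendsto_iff_norm_sub_tendsto_zero] at h1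
  rw [tendsto_iff_norm_sub_tendsto_zero]
  refine squeeze_zero (fun _ => norm_nonneg _) (fun F => ?_) h1
  rw [Lp.norm_def, Lp.norm_def]
  refine ENNReal.toReal_mono (Lp.eLpNorm_ne_top _) ?_
  have hms : AEStronglyMeasurable
      (toL2 (fourierSum f F) (isPeriodicTest_fourierSum f F).continuous - f : L2D d)
      (volume.restrict (unitCube d)) := Lp.aestronglyMeasurable _
  rw [← eLpNorm_comp_measurePreserving hms hσ]
  refine eLpNorm_mono_ae ?_
  have h2 := hσ.quasiMeasurePreserving.ae_eq_comp (Lp.coeFn_sub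
    (toL2 (fourierSum f F) (isPeriodicTest_fourierSum f F).continuous) f)
  have h3 := hσ.quasiMeasurePreserving.ae_eq_comp
    (coeFn_toL2 _ (isPeriodicTest_fourierSum f F).continuous)
  have h4 := Lp.coeFn_sub (∑ k ∈ F, UnitAddTorus.mFourierCoeff (hf.toLp _) k •
    UnitAddTorus.mFourierLp 2 k) (hf.toLp _)
  have h5 : ∀ G : Finset (Fin d → ℤ), ∀ᵐ x, (∑ k ∈ G, UnitAddTorus.mFourierCoeff (hf.toLp _) k •
      UnitAddTorus.mFourierLp 2 k : Lp ℂ 2 (volume : Measure (UnitAddTorus (Fin d)))) x =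
      ∑ k ∈ G, UnitAddTorus.mFourierCoeff (hf.toLp _) k * UnitAddTorus.mFourier k x := by
    classical
    intro G
    induction G using Finset.induction_on with
    | empty => simpa using! Lp.coeFn_zero (E := ℂ) (p := 2) (μ := (volume : Measure (UnitAddTorus (Fin d))))
    | insert k G hk ih =>
      simp only [Finset.sum_insert hk]
      filter_upwards [ih, Lp.coeFn_add (UnitAddTorus.mFourierCoeff (hf.toLp _) k •
        UnitAddTorus.mFourierLp 2 k) (∑ k ∈ G, UnitAddTorus.mFourierCoeff (hf.toLp _) k •
        UnitAddTorus.mFourierLp 2 k), Lp.coeFn_smul (UnitAddTorus.mFourierCoeff (hf.toLp _) k)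
        (UnitAddTorus.mFourierLp 2 k), UnitAddTorus.coeFn_mFourierLp 2 k] with x h1 h2 h3 h4
      rw [h2, Pi.add_apply, h1, h3, Pi.smul_apply, h4, smul_eq_mul]
  filter_upwards [h2, h3, h4, h5 F, hf.coeFn_toLp] with x h2 h3 h4 h5 h6
  have h7 : ((toL2 (fourierSum f F) (isPeriodicTest_fourierSum f F).continuous - f : L2D d) ∘
      torusSection) x = Complex.re ((∑ k ∈ F, UnitAddTorus.mFourierCoeff (hf.toLp _) k •
    UnitAddTorus.mFourierLp 2 k - hf.toLp _ :
      Lp ℂ 2 (volume : Measure (UnitAddTorus (Fin d)))) x) := by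
    rw [h2, h4]
    simp only [Function.comp_apply, Pi.sub_apply, Complex.sub_re] at h3 ⊢
    rw [h3, h5, h6, Complex.ofReal_re, Complex.re_sum, fourierSum]
    congr 1
    refine Finset.sum_congr rfl fun k _ => ?_
    rw [hcoeff, mFourier_torusSection]
    simp [-Complex.ofReal_cos, -Complex.ofReal_sin]
  rw [h7]
  exact Complex.abs_re_le_norm _

/-- Elements of `H¹_per(D)` are limits of smooth periodic functions. -/
lemma H1per.exists_approx (p : H1per d) :
    ∃ (φ : Finset (Fin d → ℤ) → (Fin d → ℝ) → ℝ) (hφ : ∀ n, IsPeriodicTest (φ n)),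
      Tendsto (fun n => toL2 (φ n) (hφ n).continuous) atTop (𝓝 (embed p)) ∧
      ∀ i, Tendsto (fun n => toL2 _ ((hφ n).continuous_fderiv (Pi.single i 1))) atTop
        (𝓝 (grad p i)) := by
  refine ⟨fourierSum (embed p), isPeriodicTest_fourierSum _, tendsto_fourierSum _, fun i => ?_⟩
  simp only [fderiv_fourierSum (H1per.isPeriodicWeakGradient p)]
  exact tendsto_fourierSum _

end SchroedingerPer

/-! ### The Poincaré inequality on convex subsets -/

namespace SchroedingerPer

open scoped InnerProductSpace ENNReal
open Filter Topology

variable {d : ℕ}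

/-- The squared Euclidean length of the gradient. -/
noncomputable def gradSq (φ : (Fin d → ℝ) → ℝ) (x : Fin d → ℝ) : ℝ :=
  ∑ i, fderiv ℝ φ x (Pi.single i 1) ^ 2

lemma gradSq_nonneg (φ : (Fin d → ℝ) → ℝ) (x : Fin d → ℝ) : 0 ≤ gradSq φ x :=
  Finset.sum_nonneg fun _ _ => sq_nonneg _

lemma continuous_gradSq {φ : (Fin d → ℝ) → ℝ} (hφ : ContDiff ℝ ∞ φ) : Continuous (gradSq φ) :=
  continuous_finsetSum _ fun _ _ =>
    ((hφ.continuous_fderiv (by simp)).clm_apply continuous_const).pow 2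

lemma fderiv_apply_sq_le (φ : (Fin d → ℝ) → ℝ) (x h : Fin d → ℝ) {L : ℝ} (hh : ∀ i, |h i| ≤ L) :
    (fderiv ℝ φ x h) ^ 2 ≤ d * L ^ 2 * gradSq φ x := by
  have h1 : fderiv ℝ φ x h = ∑ i, h i * fderiv ℝ φ x (Pi.single i 1) := by
    conv_lhs => rw [← Finset.univ_sum_single h, map_sum]
    refine Finset.sum_congr rfl fun i _ => ?_
    have : (Pi.single i (h i) : Fin d → ℝ) = h i • Pi.single i 1 := by
      rw [← Pi.single_smul, smul_eq_mul, mul_one]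
    rw [this, map_smul, smul_eq_mul]
  rw [h1]
  refine (Finset.sum_mul_sq_le_sq_mul_sq _ _ _).trans ?_
  refine mul_le_mul_of_nonneg_right ?_ (gradSq_nonneg φ x)
  calc ∑ i, h i ^ 2 ≤ ∑ _i : Fin d, L ^ 2 :=
        Finset.sum_le_sum fun i _ => sq_le_sq' (by linarith [neg_abs_le (h i), hh i])
          ((le_abs_self _).trans (hh i))
    _ = d * L ^ 2 := by simp

lemma sq_integral_le {f : ℝ → ℝ} (hf : Continuous f) :
    (∫ t in (0 : ℝ)..1, f t) ^ 2 ≤ ∫ t in (0 : ℝ)..1, f t ^ 2 := by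
  set c := ∫ t in (0 : ℝ)..1, f t with hc
  have h1 : 0 ≤ ∫ t in (0 : ℝ)..1, (f t - c) ^ 2 :=
    intervalIntegral.integral_nonneg zero_le_one fun t _ => sq_nonneg _
  have h2 : ∫ t in (0 : ℝ)..1, (f t - c) ^ 2 = (∫ t in (0 : ℝ)..1, f t ^ 2) - c ^ 2 := by
    have : ∀ t, (f t - c) ^ 2 = f t ^ 2 - 2 * c * f t + c ^ 2 := fun t => by ring
    simp only [this]
    rw [intervalIntegral.integral_add, intervalIntegral.integral_sub,
      intervalIntegral.integral_const_mul, ← hc]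
    · simp; ring
    all_goals exact Continuous.intervalIntegrable (by fun_prop) _ _
  linarith

/-- Fundamental theorem of calculus along the segment, then Jensen for the square and Cauchy–Schwarz
for the directional derivative. -/
lemma sub_sq_le {φ : (Fin d → ℝ) → ℝ} (hφ : ContDiff ℝ ∞ φ) {x y : Fin d → ℝ} {L : ℝ}
    (hxy : ∀ i, |x i - y i| ≤ L) :
    (φ x - φ y) ^ 2 ≤ d * L ^ 2 * ∫ t in (0 : ℝ)..1, gradSq φ (y + t • (x - y)) := by
  have hdiff : Differentiable ℝ φ := hφ.differentiable (by simp)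
  have hcd : Continuous (fderiv ℝ φ) := hφ.continuous_fderiv (by simp)
  have hline : Continuous fun t : ℝ => y + t • (x - y) := by fun_prop
  have hf : Continuous fun t : ℝ => fderiv ℝ φ (y + t • (x - y)) (x - y) :=
    (hcd.comp hline).clm_apply continuous_const
  have h1 : ∫ t in (0 : ℝ)..1, fderiv ℝ φ (y + t • (x - y)) (x - y) = φ x - φ y := by
    have := intervalIntegral.integral_eq_sub_of_hasDerivAt (a := 0) (b := 1)
      (f := fun t : ℝ => φ (y + t • (x - y)))
      (f' := fun t : ℝ => fderiv ℝ φ (y + t • (x - y)) (x - y)) (fun t _ => by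
        have h2 : HasDerivAt (fun t : ℝ => y + t • (x - y)) (x - y) t := by
          simpa using ((hasDerivAt_id t).smul_const (x - y)).const_add y
        exact (hdiff _).hasFDerivAt.comp_hasDerivAt t h2) (hf.intervalIntegrable _ _)
    simpa using this
  rw [← h1, ← intervalIntegral.integral_const_mul]
  refine (sq_integral_le hf).trans ?_
  refine intervalIntegral.integral_mono_on zero_le_one ((hf.pow 2).intervalIntegrable _ _)
    ((continuous_const.mul ((continuous_gradSq hφ).comp hline)).intervalIntegrable _ _)
    fun t _ => fderiv_apply_sq_le φ _ _ hxy

lemma lintegral_comp_add_smul {F : (Fin d → ℝ) → ℝ≥0∞} (hF : Measurable F) (c : Fin d → ℝ) {t : ℝ}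
    (ht : t ≠ 0) : ∫⁻ x, F (c + t • x) = ENNReal.ofReal |(t ^ d)⁻¹| * ∫⁻ x, F x := by
  have h1 : ∫⁻ x, F (c + t • x) = ∫⁻ y, F (c + y) ∂(Measure.map (t • ·) volume) :=
    (lintegral_map (f := fun y => F (c + y)) (by fun_prop) (measurable_const_smul t)).symm
  rw [h1, Measure.map_addHaar_smul _ ht, lintegral_smul_measure, lintegral_add_left_eq_self F c]
  simp

/-- Averaging a nonnegative function at an intermediate point of two points of a convex set. -/
lemma lintegral_lintegral_convexComb_le {Q : Set (Fin d → ℝ)} (hQ : Convex ℝ Q)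
    (hQm : MeasurableSet Q) {h : (Fin d → ℝ) → ℝ≥0∞} (hh : Measurable h) {t : ℝ}
    (ht : 1 / 2 ≤ t) (ht1 : t ≤ 1) :
    ∫⁻ y in Q, ∫⁻ x in Q, h (y + t • (x - y)) ≤ 2 ^ d * volume Q * ∫⁻ x in Q, h x := by
  -- For fixed `y` the point `(1 - t) y + t x` is a dilation of `x` that stays in `Q` by convexity;
  -- its Jacobian `t ^ d` is at least `2 ^ (-d)` because `t ≥ 1 / 2`.
  have h1 : ∀ y ∈ Q, ∫⁻ x in Q, h (y + t • (x - y)) ≤ 2 ^ d * ∫⁻ x in Q, h x := by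
    intro y hy
    have hF : Measurable (Q.indicator h) := hh.indicator hQm
    calc ∫⁻ x in Q, h (y + t • (x - y))
        = ∫⁻ x in Q, Q.indicator h ((1 - t) • y + t • x) := by
          refine setLIntegral_congr_fun hQm fun x hx => ?_
          have h2 : (1 - t) • y + t • x ∈ Q := hQ hy hx (by linarith) (by linarith) (by ring)
          have h3 : y + t • (x - y) = (1 - t) • y + t • x := by module
          simp only [Set.indicator_of_mem h2, h3]
      _ ≤ ∫⁻ x, Q.indicator h ((1 - t) • y + t • x) := setLIntegral_le_lintegral _ _
      _ = ENNReal.ofReal |(t ^ d)⁻¹| * ∫⁻ x, Q.indicator h x :=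
          lintegral_comp_add_smul hF _ (by linarith)
      _ ≤ 2 ^ d * ∫⁻ x in Q, h x := by
          rw [lintegral_indicator hQm]
          gcongr
          have h4 : |(t ^ d)⁻¹| ≤ 2 ^ d := by
            rw [abs_of_nonneg (by positivity), inv_le_comm₀ (by positivity) (by positivity),
              ← inv_pow]
            exact pow_le_pow_left₀ (by norm_num) (by linarith) d
          refine (ENNReal.ofReal_le_ofReal h4).trans ?_
          rw [ENNReal.ofReal_pow (by norm_num)]
          simp
  refine (setLIntegral_mono measurable_const h1).trans ?_
  rw [setLIntegral_const]
  exact le_of_eq (by ring)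

/-- For `t < 1 / 2` the dilation in `x` degenerates. Exchanging the roles of `x` and `y` replaces
`t` by `1 - t`. -/
lemma lintegral_convexComb_le {Q : Set (Fin d → ℝ)} (hQ : Convex ℝ Q)
    (hQm : MeasurableSet Q) {h : (Fin d → ℝ) → ℝ≥0∞} (hh : Measurable h) {t : ℝ}
    (ht0 : 0 ≤ t) (ht1 : t ≤ 1) :
    ∫⁻ y in Q, ∫⁻ x in Q, h (y + t • (x - y)) ≤ 2 ^ d * volume Q * ∫⁻ x in Q, h x := by
  rcases le_total (1 / 2) t with ht | ht
  · exact lintegral_lintegral_convexComb_le hQ hQm hh ht ht1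
  · rw [lintegral_lintegral_swap]
    · refine le_trans (le_of_eq ?_) (lintegral_lintegral_convexComb_le hQ hQm hh (t := 1 - t)
        (by linarith) (by linarith))
      refine lintegral_congr fun x => lintegral_congr fun y => ?_
      congr 1
      module
    · exact (hh.comp (by fun_prop)).aemeasurable

/-- The segment estimate is integrated over both endpoints. Tonelli moves `t` outermost, so the
averaging bound applies for each `t` separately. -/
lemma lintegral_sub_sq_le {Q : Set (Fin d → ℝ)} (hQ : Convex ℝ Q) (hQm : MeasurableSet Q) {L : ℝ}
    (hL : ∀ x ∈ Q, ∀ y ∈ Q, ∀ i, |x i - y i| ≤ L) {φ : (Fin d → ℝ) → ℝ} (hφ : ContDiff ℝ ∞ φ) :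
    ∫⁻ y in Q, ∫⁻ x in Q, ENNReal.ofReal ((φ x - φ y) ^ 2) ≤
      ENNReal.ofReal (d * L ^ 2) * (2 ^ d * volume Q * ∫⁻ x in Q, ENNReal.ofReal (gradSq φ x)) := by
  set h : (Fin d → ℝ) → ℝ≥0∞ := fun x => ENNReal.ofReal (gradSq φ x) with hh
  have hhm : Measurable h := (continuous_gradSq hφ).measurable.ennreal_ofReal
  have h1 : ∀ y ∈ Q, ∀ x ∈ Q, ENNReal.ofReal ((φ x - φ y) ^ 2) ≤
      ENNReal.ofReal (d * L ^ 2) * ∫⁻ t in Set.Ioc (0 : ℝ) 1, h (y + t • (x - y)) := by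
    intro y hy x hx
    have hc : Continuous fun t : ℝ => gradSq φ (y + t • (x - y)) :=
      (continuous_gradSq hφ).comp (by fun_prop)
    rw [← ofReal_integral_eq_lintegral_ofReal
      ((intervalIntegrable_iff_integrableOn_Ioc_of_le zero_le_one).1 (hc.intervalIntegrable _ _))
      (Eventually.of_forall fun t => gradSq_nonneg _ _), ← ENNReal.ofReal_mul (by positivity),
      ← intervalIntegral.integral_of_le zero_le_one]
    exact ENNReal.ofReal_le_ofReal (sub_sq_le hφ (hL x hx y hy))
  have hm : Measurable fun p : (Fin d → ℝ) × (Fin d → ℝ) × ℝ =>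
      h (p.1 + p.2.2 • (p.2.1 - p.1)) := hhm.comp (by fun_prop)
  calc ∫⁻ y in Q, ∫⁻ x in Q, ENNReal.ofReal ((φ x - φ y) ^ 2)
      ≤ ∫⁻ y in Q, ∫⁻ x in Q, ENNReal.ofReal (d * L ^ 2) *
          ∫⁻ t in Set.Ioc (0 : ℝ) 1, h (y + t • (x - y)) :=
        setLIntegral_mono' hQm fun y hy => setLIntegral_mono' hQm fun x hx => h1 y hy x hx
    _ = ENNReal.ofReal (d * L ^ 2) * ∫⁻ y in Q, ∫⁻ x in Q,
          ∫⁻ t in Set.Ioc (0 : ℝ) 1, h (y + t • (x - y)) := by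
        rw [← lintegral_const_mul' _ _ ENNReal.ofReal_ne_top]
        refine lintegral_congr fun y => ?_
        rw [lintegral_const_mul' _ _ ENNReal.ofReal_ne_top]
    _ = ENNReal.ofReal (d * L ^ 2) * ∫⁻ t in Set.Ioc (0 : ℝ) 1, ∫⁻ y in Q, ∫⁻ x in Q,
          h (y + t • (x - y)) := by
        congr 1
        have h2 : ∀ y, ∫⁻ x in Q, ∫⁻ t in Set.Ioc (0 : ℝ) 1, h (y + t • (x - y)) =
            ∫⁻ t in Set.Ioc (0 : ℝ) 1, ∫⁻ x in Q, h (y + t • (x - y)) := fun y =>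
          lintegral_lintegral_swap (hhm.comp (by fun_prop)).aemeasurable
        simp only [h2]
        refine lintegral_lintegral_swap (Measurable.aemeasurable ?_)
        refine Measurable.lintegral_prod_right' (f := fun p : ((Fin d → ℝ) × ℝ) × (Fin d → ℝ) =>
          h (p.1.1 + p.1.2 • (p.2 - p.1.1))) ?_
        exact hhm.comp (by fun_prop)
    _ ≤ ENNReal.ofReal (d * L ^ 2) * ∫⁻ _ in Set.Ioc (0 : ℝ) 1,
          2 ^ d * volume Q * ∫⁻ x in Q, h x := by
        gcongr ENNReal.ofReal (d * L ^ 2) * ?_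
        exact setLIntegral_mono' measurableSet_Ioc fun t ht =>
          lintegral_convexComb_le hQ hQm hhm ht.1.le ht.2
    _ = _ := by simp

/-- The constant in the Poincaré inequality. -/
noncomputable def poincareConst (d : ℕ) : ℝ := d * 2 ^ d

lemma poincareConst_nonneg : 0 ≤ poincareConst d := by unfold poincareConst; positivity

lemma measure_ne_top_of_subset_unitCube {Q : Set (Fin d → ℝ)} (hQ : Q ⊆ unitCube d) :
    volume Q ≠ ⊤ := by
  have h2 : volume (unitCube d) = 1 := by
    rw [← Measure.restrict_apply_univ]; exact measure_univ
  exact ne_top_of_le_ne_top (by simp) ((measure_mono hQ).trans h2.le)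

/-- The double integral of `(φ x - φ y)²` equals `2 (|Q| ∫ φ² - (∫ φ)²)`. Keeping the factor `|Q|`
avoids division by a possibly zero volume; a factor `1 / 2` on the gradient term is given away. -/
lemma poincare_smooth {Q : Set (Fin d → ℝ)} (hQ : Convex ℝ Q) (hQm : MeasurableSet Q)
    (hQD : Q ⊆ unitCube d) {L : ℝ} (hL : ∀ x ∈ Q, ∀ y ∈ Q, ∀ i, |x i - y i| ≤ L)
    {φ : (Fin d → ℝ) → ℝ} (hφ : ContDiff ℝ ∞ φ) :
    volume.real Q * (∫ x in Q, φ x ^ 2) ≤ (∫ x in Q, φ x) ^ 2 +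
      poincareConst d * L ^ 2 * (volume.real Q * ∫ x in Q, gradSq φ x) := by
  have hfin := measure_ne_top_of_subset_unitCube hQD
  have : IsFiniteMeasure (volume.restrict Q) := ⟨by simpa using hfin.lt_top⟩
  have hint : ∀ f : (Fin d → ℝ) → ℝ, Continuous f → Integrable f (volume.restrict Q) := by
    intro f hf
    exact (memLp_one_iff_integrable.1 (memLp_of_continuous hf 1)).mono_measure
      (Measure.restrict_mono hQD le_rfl)
  have hc := hφ.continuous
  set S := ∫ x in Q, φ x ^ 2 with hS
  set I := ∫ x in Q, φ x with hI
  set V := volume.real Q with hV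
  have h1 : ∀ y, ∫ x in Q, (φ x - φ y) ^ 2 = S - 2 * φ y * I + V * φ y ^ 2 := by
    intro y
    have : ∀ x, (φ x - φ y) ^ 2 = φ x ^ 2 - 2 * φ y * φ x + φ y ^ 2 := fun x => by ring
    simp only [this]
    rw [integral_add (hint (fun x => φ x ^ 2 - 2 * φ y * φ x) (by fun_prop)) (integrable_const _),
      integral_sub (hint (fun x => φ x ^ 2) (by fun_prop))
        (hint (fun x => 2 * φ y * φ x) (by fun_prop)), integral_const_mul, integral_const]
    simp [hV, hS, hI, measureReal_def]
  have h2 : ∫⁻ y in Q, ∫⁻ x in Q, ENNReal.ofReal ((φ x - φ y) ^ 2) =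
      ENNReal.ofReal (2 * (V * S) - 2 * I ^ 2) := by
    have h3 : ∀ y, ∫⁻ x in Q, ENNReal.ofReal ((φ x - φ y) ^ 2) =
        ENNReal.ofReal (S - 2 * φ y * I + V * φ y ^ 2) := fun y => by
      rw [← h1, ofReal_integral_eq_lintegral_ofReal (hint _ (by fun_prop))
        (Eventually.of_forall fun x => sq_nonneg _)]
    simp only [h3]
    rw [← ofReal_integral_eq_lintegral_ofReal (hint _ (by fun_prop))
      (Eventually.of_forall fun y => by
        simp only [Pi.zero_apply]
        rw [← h1]; exact integral_nonneg fun x => sq_nonneg _)]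
    congr 1
    rw [integral_add (hint (fun y => S - 2 * φ y * I) (by fun_prop))
        (hint (fun y => V * φ y ^ 2) (by fun_prop)), integral_sub (integrable_const _)
        (hint (fun y => 2 * φ y * I) (by fun_prop)), integral_mul_const, integral_const_mul,
      integral_const_mul, integral_const]
    simp [← hS, ← hI, hV, measureReal_def]
    ring
  have h4 := lintegral_sub_sq_le hQ hQm hL hφ
  rw [h2, ← ofReal_integral_eq_lintegral_ofReal (hint _ (continuous_gradSq hφ))
    (Eventually.of_forall fun x => gradSq_nonneg _ _), ← ofReal_measureReal hfin] at h4
  have h5 : (2 : ℝ≥0∞) ^ d = ENNReal.ofReal (2 ^ d) := by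
    rw [ENNReal.ofReal_pow (by norm_num)]; simp
  have h6 : 0 ≤ ∫ x in Q, gradSq φ x := integral_nonneg fun x => gradSq_nonneg _ _
  have hV0 : 0 ≤ V := measureReal_nonneg
  rw [h5, ← ENNReal.ofReal_mul (by positivity), ← ENNReal.ofReal_mul (by positivity),
    ← ENNReal.ofReal_mul (by positivity), ENNReal.ofReal_le_ofReal_iff (by positivity)] at h4
  have h7 : 0 ≤ poincareConst d * L ^ 2 * (V * ∫ x in Q, gradSq φ x) := by
    have := poincareConst_nonneg (d := d)
    positivity
  rw [poincareConst] at h7 ⊢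
  linarith

/-! #### Integrals over subsets as continuous expressions on `L²(D)` -/

lemma memLp_indicator_one {Q : Set (Fin d → ℝ)} (hQm : MeasurableSet Q) :
    MemLp (Q.indicator fun _ => (1 : ℝ)) ∞
      ((volume : Measure (Fin d → ℝ)).restrict (unitCube d)) :=
  (memLp_const (1 : ℝ)).indicator hQm

/-- The characteristic function of a subset as an element of `L²(D)`. -/
noncomputable def charL2 (Q : Set (Fin d → ℝ)) (hQm : MeasurableSet Q) : L2D d :=
  mulOp _ (memLp_indicator_one hQm) (toL2 (fun _ => 1) continuous_const)

lemma inner_charL2 {Q : Set (Fin d → ℝ)} (hQm : MeasurableSet Q) (hQD : Q ⊆ unitCube d)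
    (f : L2D d) : ⟪charL2 Q hQm, f⟫_ℝ = ∫ x in Q, f x := by
  rw [charL2, inner_mulOp_left]
  have h1 : ∫ x in unitCube d, Q.indicator (fun _ => (1 : ℝ)) x *
      toL2 (fun _ => 1) continuous_const x * f x = ∫ x in unitCube d, Q.indicator f x := by
    refine integral_congr_ae ?_
    filter_upwards [coeFn_toL2 (d := d) (fun _ => 1) continuous_const] with x hx
    rw [hx]
    by_cases h : x ∈ Q <;> simp [h]
  rw [h1, setIntegral_indicator hQm, Set.inter_eq_right.2 hQD]

lemma inner_mulOp_indicator {Q : Set (Fin d → ℝ)} (hQm : MeasurableSet Q) (hQD : Q ⊆ unitCube d)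
    (f : L2D d) : ⟪mulOp _ (memLp_indicator_one hQm) f, f⟫_ℝ = ∫ x in Q, f x ^ 2 := by
  rw [inner_mulOp_left]
  have h1 : ∀ x, Q.indicator (fun _ => (1 : ℝ)) x * f x * f x =
      Q.indicator (fun x => f x ^ 2) x := fun x => by
    by_cases h : x ∈ Q <;> simp [h, pow_two]
  simp only [h1]
  rw [setIntegral_indicator hQm, Set.inter_eq_right.2 hQD]

lemma setIntegral_toL2 {Q : Set (Fin d → ℝ)} (hQD : Q ⊆ unitCube d) {f : (Fin d → ℝ) → ℝ}
    (hf : Continuous f) (F : ℝ → ℝ) : ∫ x in Q, F (toL2 f hf x) = ∫ x in Q, F (f x) := by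
  refine integral_congr_ae ?_
  filter_upwards [ae_mono (Measure.restrict_mono hQD le_rfl) (coeFn_toL2 f hf)] with x hx
  rw [hx]

/-- The Poincaré inequality on convex subsets of the cube, for functions in `H¹_per(D)`. -/
lemma poincare {Q : Set (Fin d → ℝ)} (hQ : Convex ℝ Q) (hQm : MeasurableSet Q)
    (hQD : Q ⊆ unitCube d) {L : ℝ} (hL : ∀ x ∈ Q, ∀ y ∈ Q, ∀ i, |x i - y i| ≤ L)
    (p : H1per d) :
    volume.real Q * (∫ x in Q, H1per.embed p x ^ 2) ≤ (∫ x in Q, H1per.embed p x) ^ 2 +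
      poincareConst d * L ^ 2 * (volume.real Q * ∑ i, ∫ x in Q, H1per.grad p i x ^ 2) := by
  obtain ⟨φ, hφ, hu, hg⟩ := H1per.exists_approx p
  -- Both sides are continuous for the `L²` convergence of functions and gradients, so the
  -- inequality passes from the smooth approximants to `p`.
  have hsq : Continuous fun f : L2D d => ∫ x in Q, f x ^ 2 := by
    simp only [← inner_mulOp_indicator hQm hQD]
    exact (ContinuousLinearMap.continuous _).inner continuous_id
  have hlin : Continuous fun f : L2D d => ∫ x in Q, f x := by
    simp only [← inner_charL2 hQm hQD]
    exact continuous_const.inner continuous_id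
  have h1 := ((hsq.tendsto _).comp hu).const_mul (volume.real Q)
  have h2 := (((hlin.tendsto _).comp hu).pow 2).add (((tendsto_finsetSum Finset.univ
    fun i _ => (hsq.tendsto _).comp (hg i)).const_mul (volume.real Q)).const_mul
      (poincareConst d * L ^ 2))
  refine le_of_tendsto_of_tendsto' h1 h2 fun n => ?_
  have h3 := poincare_smooth hQ hQm hQD hL (hφ n).1
  have h4 : ∫ x in Q, gradSq (φ n) x =
      ∑ i, ∫ x in Q, fderiv ℝ (φ n) x (Pi.single i 1) ^ 2 := by
    refine integral_finsetSum _ fun i _ => ?_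
    exact (memLp_one_iff_integrable.1 (memLp_of_continuous
      (((hφ n).continuous_fderiv _).pow 2) 1)).mono_measure (Measure.restrict_mono hQD le_rfl)
  rw [h4] at h3
  simp only [Function.comp_apply]
  have h5 := setIntegral_toL2 hQD (hφ n).continuous fun t => t ^ 2
  have h6 := setIntegral_toL2 hQD (hφ n).continuous fun t => t
  have h7 := fun i => setIntegral_toL2 hQD ((hφ n).continuous_fderiv (Pi.single i 1))
    fun t => t ^ 2
  simp only [h5, h6, h7]
  exact h3

end SchroedingerPer

/-! ### Decomposition into cells and lower bounds -/

namespace SchroedingerPer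

open scoped InnerProductSpace ENNReal
open Filter Topology CompactForm

variable {d : ℕ}

/-- The cells of the mesh of width `1 / n` in the unit cube. -/
def cell (n : ℕ) (j : Fin d → ℕ) : Set (Fin d → ℝ) :=
  Set.univ.pi fun i => Set.Ioo (0 : ℝ) 1 ∩ Set.Ico ((j i : ℝ) / n) (((j i : ℝ) + 1) / n)

lemma cell_subset (n : ℕ) (j : Fin d → ℕ) : cell n j ⊆ unitCube d :=
  Set.pi_mono fun _ _ => Set.inter_subset_left

lemma measurableSet_cell (n : ℕ) (j : Fin d → ℕ) : MeasurableSet (cell n j) :=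
  MeasurableSet.univ_pi fun _ => measurableSet_Ioo.inter measurableSet_Ico

lemma convex_cell (n : ℕ) (j : Fin d → ℕ) : Convex ℝ (cell n j) :=
  convex_pi fun _ _ => (convex_Ioo _ _).inter (convex_Ico _ _)

lemma abs_sub_le_of_mem_cell {n : ℕ} {j : Fin d → ℕ} :
    ∀ x ∈ cell n j, ∀ y ∈ cell n j, ∀ i, |x i - y i| ≤ 1 / n := by
  intro x hx y hy i
  have h1 := (hx i trivial).2
  have h2 := (hy i trivial).2
  rw [add_div] at h1 h2
  rw [abs_le]
  constructor <;> linarith [h1.1, h1.2, h2.1, h2.2]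

lemma mem_cell_iff {n : ℕ} (hn : 0 < n) {j : Fin d → ℕ} {x : Fin d → ℝ} (hx : x ∈ unitCube d) :
    x ∈ cell n j ↔ ∀ i, ⌊(n : ℝ) * x i⌋₊ = j i := by
  have hn' : (0 : ℝ) < n := by exact_mod_cast hn
  simp only [cell, Set.mem_univ_pi, Set.mem_inter_iff, Set.mem_Ico]
  refine forall_congr' fun i => ?_
  have hx0 : 0 ≤ (n : ℝ) * x i := mul_nonneg hn'.le (hx i trivial).1.le
  rw [Nat.floor_eq_iff hx0, div_le_iff₀ hn', lt_div_iff₀ hn', mul_comm (x i)]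
  exact and_iff_right (hx i trivial)

lemma iUnion_cell {n : ℕ} (hn : 0 < n) :
    ⋃ j : Fin d → Fin n, cell n (fun i => (j i : ℕ)) = unitCube d := by
  have hn' : (0 : ℝ) < n := by exact_mod_cast hn
  refine Set.Subset.antisymm (Set.iUnion_subset fun j => cell_subset _ _) fun x hx => ?_
  have h1 : ∀ i, ⌊(n : ℝ) * x i⌋₊ < n := fun i => by
    have := hx i trivial
    rw [Nat.floor_lt (mul_nonneg hn'.le this.1.le)]
    nlinarith [this.2]
  exact Set.mem_iUnion.2 ⟨fun i => ⟨_, h1 i⟩, (mem_cell_iff hn hx).2 fun i => rfl⟩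

lemma disjoint_cell {n : ℕ} (hn : 0 < n) {j k : Fin d → ℕ} (hjk : j ≠ k) :
    Disjoint (cell n j) (cell n k) := by
  rw [Set.disjoint_left]
  intro x hx hx'
  have hxD := cell_subset n j hx
  rw [mem_cell_iff hn hxD] at hx hx'
  exact hjk (funext fun i => (hx i).symm.trans (hx' i))

lemma sum_integral_cell {n : ℕ} (hn : 0 < n) {f : (Fin d → ℝ) → ℝ}
    (hf : Integrable f (volume.restrict (unitCube d))) :
    ∫ x in unitCube d, f x = ∑ j : Fin d → Fin n, ∫ x in cell n (fun i => (j i : ℕ)), f x := by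
  rw [← iUnion_cell hn, integral_iUnion_fintype (fun j => measurableSet_cell _ _)]
  · intro j k hjk
    exact disjoint_cell hn fun h => hjk (funext fun i => Fin.ext (congrFun h i))
  · intro j
    exact IntegrableOn.mono_set hf (cell_subset _ _)

/-- The energy of a function on a subset of the cube. -/
noncomputable def energyOn (V : (Fin d → ℝ) → ℝ) (p : H1per d) (Q : Set (Fin d → ℝ)) : ℝ :=
  (∑ i, ∫ x in Q, H1per.grad p i x ^ 2) + ∫ x in Q, V x * H1per.embed p x ^ 2

lemma integrableOn_sq (f : L2D d) {Q : Set (Fin d → ℝ)} (hQ : Q ⊆ unitCube d) :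
    IntegrableOn (fun x => f x ^ 2) Q :=
  IntegrableOn.mono_set (Lp.memLp f).integrable_sq hQ

lemma integrableOn_L2D (f : L2D d) {Q : Set (Fin d → ℝ)} (hQ : Q ⊆ unitCube d) :
    IntegrableOn f Q :=
  IntegrableOn.mono_set ((Lp.memLp f).integrable one_le_two) hQ

variable {V : (Fin d → ℝ) → ℝ}

lemma integrableOn_mul_sq (hV : MemLp V ∞ (volume.restrict (unitCube d))) (f : L2D d)
    {Q : Set (Fin d → ℝ)} (hQ : Q ⊆ unitCube d) : IntegrableOn (fun x => V x * f x ^ 2) Q := by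
  refine IntegrableOn.mono_set ?_ hQ
  refine (integrable_mul_mul_L2D hV f f).congr (Eventually.of_forall fun x => ?_)
  simp only; ring

lemma energyOn_unitCube (hV : MemLp V ∞ (volume.restrict (unitCube d))) (p : H1per d) :
    energyOn V p (unitCube d) = form H1per.embed (mulOp V hV - 1) p p := by
  rw [form_H1per, inner_mulOp_left, energyOn]
  simp only [real_inner_self_eq_norm_sq, norm_sq_L2D]
  congr 1
  exact integral_congr_ae (Eventually.of_forall fun x => by simp only; ring)

/-- Cellwise energy bounds add up. -/
lemma energy_ge_of_cells (hV : MemLp V ∞ (volume.restrict (unitCube d))) {n : ℕ} (hn : 0 < n)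
    (p : H1per d) {T : ℝ} (h : ∀ j : Fin d → Fin n,
      T * ∫ x in cell n (fun i => (j i : ℕ)), H1per.embed p x ^ 2 ≤
        energyOn V p (cell n fun i => (j i : ℕ))) :
    T * ‖H1per.embed p‖ ^ 2 ≤ form H1per.embed (mulOp V hV - 1) p p := by
  have h1 : energyOn V p (unitCube d) =
      ∑ j : Fin d → Fin n, energyOn V p (cell n fun i => (j i : ℕ)) := by
    unfold energyOn
    rw [Finset.sum_add_distrib, Finset.sum_comm,
      sum_integral_cell hn (integrableOn_mul_sq hV (H1per.embed p) subset_rfl)]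
    congr 1
    exact Finset.sum_congr rfl fun i _ =>
      sum_integral_cell hn (integrableOn_sq (H1per.grad p i) subset_rfl)
  rw [← energyOn_unitCube, h1, norm_sq_L2D,
    sum_integral_cell hn (integrableOn_sq (H1per.embed p) subset_rfl), Finset.mul_sum]
  exact Finset.sum_le_sum fun j _ => h j

lemma grad_le_energyOn {p : H1per d} {Q : Set (Fin d → ℝ)} (hQ : MeasurableSet Q)
    (hV0 : ∀ x ∈ Q, 0 ≤ V x) : ∑ i, ∫ x in Q, H1per.grad p i x ^ 2 ≤ energyOn V p Q :=
  le_add_of_nonneg_right (setIntegral_nonneg hQ fun x hx => mul_nonneg (hV0 x hx) (sq_nonneg _))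

lemma sum_grad_nonneg (p : H1per d) (Q : Set (Fin d → ℝ)) :
    0 ≤ ∑ i, ∫ x in Q, H1per.grad p i x ^ 2 :=
  Finset.sum_nonneg fun _ _ => integral_nonneg fun _ => sq_nonneg _

/-- On a cell where the mean vanishes, the energy controls the square integral. -/
lemma energy_ge_of_integral_eq_zero {n : ℕ} {p : H1per d} {j : Fin d → ℕ}
    (hV0 : ∀ x, 0 ≤ V x) (hp : ∫ x in cell n j, H1per.embed p x = 0) {T : ℝ} (hT0 : 0 ≤ T)
    (hT : T * (poincareConst d * (1 / n) ^ 2) ≤ 1) :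
    T * ∫ x in cell n j, H1per.embed p x ^ 2 ≤ energyOn V p (cell n j) := by
  have h1 := poincare (convex_cell n j) (measurableSet_cell n j) (cell_subset n j)
    abs_sub_le_of_mem_cell p
  have h3 := sum_grad_nonneg p (cell n j)
  refine le_trans ?_ (grad_le_energyOn (measurableSet_cell n j) fun x _ => hV0 x)
  -- The index `j` is unrestricted, so the cell may be null, and then the volume factor in Poincaré
  -- cannot be cancelled.
  rcases (measureReal_nonneg : 0 ≤ volume.real (cell n j)).eq_or_lt with h0 | h0
  · have h2 : volume (cell n j) = 0 :=
      (measureReal_eq_zero_iff (measure_ne_top_of_subset_unitCube (cell_subset n j))).1 h0.symm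
    rw [Measure.restrict_eq_zero.2 h2, integral_zero_measure, mul_zero]
    rwa [Measure.restrict_eq_zero.2 h2] at h3
  · rw [hp] at h1
    have h2 : ∫ x in cell n j, H1per.embed p x ^ 2 ≤
        poincareConst d * (1 / n) ^ 2 * ∑ i, ∫ x in cell n j, H1per.grad p i x ^ 2 := by
      refine le_of_mul_le_mul_left ?_ h0
      linarith
    calc T * ∫ x in cell n j, H1per.embed p x ^ 2
        ≤ T * (poincareConst d * (1 / n) ^ 2 * ∑ i, ∫ x in cell n j, H1per.grad p i x ^ 2) :=
          mul_le_mul_of_nonneg_left h2 hT0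
      _ = (T * (poincareConst d * (1 / n) ^ 2)) *
            ∑ i, ∫ x in cell n j, H1per.grad p i x ^ 2 := by ring
      _ ≤ 1 * ∑ i, ∫ x in cell n j, H1per.grad p i x ^ 2 := mul_le_mul_of_nonneg_right hT h3
      _ = _ := one_mul _

lemma mul_integral_sq_le_of_le {Q : Set (Fin d → ℝ)} (hQ : MeasurableSet Q)
    (hQD : Q ⊆ unitCube d) (hV : MemLp V ∞ (volume.restrict (unitCube d))) {b : ℝ}
    (hb : ∀ x ∈ Q, b ≤ V x) (f : L2D d) : b * ∫ x in Q, f x ^ 2 ≤ ∫ x in Q, V x * f x ^ 2 := by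
  rw [← integral_const_mul]
  exact setIntegral_mono_on ((integrableOn_sq f hQD).const_mul b) (integrableOn_mul_sq hV f hQD) hQ
    fun x hx => mul_le_mul_of_nonneg_right (hb x hx) (sq_nonneg _)

/-- The form dominates `T ‖·‖²` if the means over some cells vanish and the potential is at least
`T` on the other cells. -/
lemma form_ge_of_constraints (hV : MemLp V ∞ (volume.restrict (unitCube d))) (hV0 : ∀ x, 0 ≤ V x)
    {n : ℕ} (hn : 0 < n) (A : Finset (Fin d → Fin n)) {T : ℝ} (hT0 : 0 ≤ T)
    (hT : T * (poincareConst d * (1 / n) ^ 2) ≤ 1)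
    (hA : ∀ j ∉ A, ∀ x ∈ cell n (fun i => (j i : ℕ)), T ≤ V x) (p : H1per d)
    (hp : ∀ j ∈ A, ⟪charL2 _ (measurableSet_cell n fun i => (j i : ℕ)), H1per.embed p⟫_ℝ = 0) :
    T * ‖H1per.embed p‖ ^ 2 ≤ form H1per.embed (mulOp V hV - 1) p p := by
  refine energy_ge_of_cells hV hn p fun j => ?_
  by_cases hj : j ∈ A
  · refine energy_ge_of_integral_eq_zero hV0 ?_ hT0 hT
    rw [← inner_charL2 (measurableSet_cell _ _) (cell_subset _ _), hp j hj]
  · exact (mul_integral_sq_le_of_le (measurableSet_cell _ _) (cell_subset _ _) hV (hA j hj) _).trans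
      (le_add_of_nonneg_left (sum_grad_nonneg p _))

/-- Zero mean on every cell of a mesh of width `1 / n`, with `n` so large that the Poincaré constant
`poincareConst d / n²` is at most `1 / T`. Since `n ≥ 1`, it suffices that `n` exceeds `T *
poincareConst d`. -/
lemma exists_constraints (hV : MemLp V ∞ (volume.restrict (unitCube d))) (hV0 : ∀ x, 0 ≤ V x)
    (T : ℝ) : ∃ s : Finset (L2D d), ∀ p : H1per d, (∀ x ∈ s, ⟪x, H1per.embed p⟫_ℝ = 0) →
      T * ‖H1per.embed p‖ ^ 2 ≤ form H1per.embed (mulOp V hV - 1) p p := by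
  classical
  obtain ⟨n, hn⟩ := exists_nat_gt (max T 0 * poincareConst d)
  have hC := poincareConst_nonneg (d := d)
  have hT0 : 0 ≤ max T 0 := le_max_right _ _
  have hn0 : (0 : ℝ) < n := lt_of_le_of_lt (mul_nonneg hT0 hC) hn
  have hn1 : 0 < n := by exact_mod_cast hn0
  have hn1' : (1 : ℝ) ≤ n := by exact_mod_cast hn1
  refine ⟨Finset.univ.image fun j : Fin d → Fin n =>
    charL2 _ (measurableSet_cell n fun i => (j i : ℕ)), fun p hp => ?_⟩
  refine le_trans (mul_le_mul_of_nonneg_right (le_max_left T 0) (sq_nonneg _))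
    (form_ge_of_constraints hV hV0 hn1 Finset.univ hT0 ?_ (by simp) p fun j _ =>
      hp _ (Finset.mem_image_of_mem _ (Finset.mem_univ j)))
  rw [one_div, inv_pow, ← mul_assoc, ← div_eq_mul_inv, div_le_one (by positivity)]
  nlinarith

/-- Rellich's theorem from Poincaré: with zero potential and `T = 1 / ε²`, finitely many vanishing
means give `‖u‖ ≤ ε ‖u‖_{H¹}`. -/
lemma isCompactOperator_embed : IsCompactOperator (H1per.embed (d := d)) := by
  refine isCompactOperator_of_constraints fun ε hε => ?_
  have hV : MemLp (fun _ : Fin d → ℝ => (0 : ℝ)) ∞ (volume.restrict (unitCube d)) := memLp_const 0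
  obtain ⟨s, hs⟩ := exists_constraints hV (fun _ => le_rfl) (1 / ε ^ 2)
  refine ⟨s, fun p hp => ?_⟩
  have h1 := hs p hp
  rw [form_H1per, inner_mulOp_left] at h1
  simp only [zero_mul, integral_zero, add_zero, real_inner_self_eq_norm_sq] at h1
  have h2 := H1per.norm_sq_eq p
  have h3 : ‖H1per.embed p‖ ^ 2 ≤ ε ^ 2 * ‖p‖ ^ 2 := by
    rw [one_div, inv_mul_le_iff₀ (by positivity)] at h1
    refine h1.trans (mul_le_mul_of_nonneg_left ?_ (by positivity))
    linarith [sq_nonneg ‖H1per.embed p‖]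
  rw [← mul_pow] at h3
  exact le_of_sq_le_sq h3 (by positivity)

end SchroedingerPer

/-! ### The periodic potential: lower bounds -/

namespace SchroedingerPer

open scoped InnerProductSpace ENNReal
open Filter Topology CompactForm

variable {d : ℕ}

lemma periodicPotential_of_forall {ε α β : ℝ} {s : Fin d → ℤ} {x : Fin d → ℝ}
    (h : ∀ i, Even (⌊x i / ε⌋ - s i)) : periodicPotential ε s α β x = α := if_pos h

lemma periodicPotential_of_not {ε α β : ℝ} {s : Fin d → ℤ} {x : Fin d → ℝ}
    (h : ¬ ∀ i, Even (⌊x i / ε⌋ - s i)) : periodicPotential ε s α β x = β := if_neg h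

lemma periodicPotential_nonneg {ε α β : ℝ} (s : Fin d → ℤ) (hα : 0 ≤ α) (hβ : 0 ≤ β)
    (x : Fin d → ℝ) : 0 ≤ periodicPotential ε s α β x := by
  unfold periodicPotential
  split_ifs <;> assumption

lemma measurableSet_forall_even (ε : ℝ) (s : Fin d → ℤ) :
    MeasurableSet {x : Fin d → ℝ | ∀ i, Even (⌊x i / ε⌋ - s i)} := by
  have h1 : {x : Fin d → ℝ | ∀ i, Even (⌊x i / ε⌋ - s i)} =
      ⋂ i, (fun x : Fin d → ℝ => ⌊x i / ε⌋) ⁻¹' {z | Even (z - s i)} := by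
    ext x; simp
  rw [h1]
  refine MeasurableSet.iInter fun i => ?_
  exact (Int.measurable_floor.comp ((measurable_pi_apply (X := fun _ : Fin d => ℝ) i).div_const ε)) trivial

lemma memLp_periodicPotential (ε : ℝ) (s : Fin d → ℤ) (α β : ℝ) :
    MemLp (periodicPotential ε s α β) ∞
      ((volume : Measure (Fin d → ℝ)).restrict (unitCube d)) := by
  classical
  have h1 : Measurable (periodicPotential ε s α β) := by
    unfold periodicPotential
    exact Measurable.ite (measurableSet_forall_even ε s) measurable_const measurable_const
  refine memLp_top_of_bound h1.aestronglyMeasurable (max |α| |β|) (Eventually.of_forall fun x => ?_)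
  unfold periodicPotential
  split_ifs
  · exact le_max_left _ _
  · exact le_max_right _ _

lemma IsPeriodicSetting.exists_nat {ε : ℝ} {N : ℕ} {α β : ℝ} (h : IsPeriodicSetting d ε N α β) :
    ∃ m : ℕ, 0 < m ∧ ε = 1 / (2 * (m : ℝ)) ∧ N = m ^ d := by
  obtain ⟨m, hm, rfl⟩ := h.eps_eq
  refine ⟨m, hm, rfl, ?_⟩
  have hm' : (m : ℝ) ≠ 0 := by exact_mod_cast hm.ne'
  have h1 := h.card_eq
  have h2 : 2 * (1 / (2 * (m : ℝ))) = (m : ℝ)⁻¹ := by field_simp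
  rw [h2, inv_pow, inv_inv] at h1
  exact_mod_cast h1

/-- The mesh of width `1 / (2 m l)` refines the `ε`-mesh by a factor `l`, so integer division by `l`
recovers the index of the surrounding `ε`-cube. Whether a subcell lies in an `α`-cube is thereby
decided by its index. -/
lemma floor_div_of_mem_cell {m l : ℕ} (hm : 0 < m) (hl : 0 < l) {j : Fin d → ℕ} {x : Fin d → ℝ}
    (hx : x ∈ cell (2 * m * l) j) (i : Fin d) :
    ⌊x i / (1 / (2 * (m : ℝ)))⌋ = ((j i / l : ℕ) : ℤ) := by
  have h1 := (hx i trivial).2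
  have hm' : (0 : ℝ) < m := by exact_mod_cast hm
  have hl' : (0 : ℝ) < l := by exact_mod_cast hl
  rw [Set.mem_Ico, div_le_iff₀ (by positivity), lt_div_iff₀ (by positivity)] at h1
  push_cast at h1
  rw [one_div, div_inv_eq_mul, Int.floor_eq_iff]
  have h2 : ((l * (j i / l) : ℕ) : ℝ) ≤ j i := by exact_mod_cast Nat.mul_div_le _ _
  have h3 : (j i : ℝ) + 1 ≤ ((l * (j i / l + 1) : ℕ) : ℝ) := by
    exact_mod_cast Nat.lt_mul_div_succ (j i) hl
  generalize j i / l = q at h2 h3 ⊢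
  push_cast at h2 h3 ⊢
  constructor
  · refine le_of_mul_le_mul_left ?_ hl'
    linarith [h1.1]
  · refine lt_of_mul_lt_mul_left ?_ hl'.le
    linarith [h1.2]

/-- The subcells of order `l` of the `α`-cubes. -/
def alphaCells (m l : ℕ) (s : Fin d → ℤ) : Finset (Fin d → Fin (2 * m * l)) :=
  Fintype.piFinset fun i => Finset.univ.filter fun j => Even ((((j : ℕ) / l : ℕ) : ℤ) - s i)

/-- The quotient `j / l` ranges below `2 m` with parity prescribed by `s`, so it is determined by
its half; the remainder `j % l` is free. -/
lemma card_filter_even_le {m l : ℕ} (s : ℤ) :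
    (Finset.univ.filter fun j : Fin (2 * m * l) => Even ((((j : ℕ) / l : ℕ) : ℤ) - s)).card
      ≤ m * l := by
  have h1 : (Finset.range m ×ˢ Finset.range l).card = m * l := by simp
  rw [← h1]
  refine Finset.card_le_card_of_injOn (fun j => ((j : ℕ) / l / 2, (j : ℕ) % l)) ?_ ?_
  · intro j _
    have hj := j.2
    have hl : 0 < l := by
      rcases Nat.eq_zero_or_pos l with rfl | h
      · simp at hj
      · exact h
    have h2 : (j : ℕ) / l < 2 * m := Nat.div_lt_of_lt_mul (by rw [mul_comm l]; exact hj)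
    simp only [Finset.coe_product, Finset.coe_range, Set.mem_prod, Set.mem_Iio]
    exact ⟨by omega, Nat.mod_lt _ hl⟩
  · intro j hj k hk hjk
    simp only [Finset.coe_filter, Finset.mem_univ, true_and, Set.mem_ofPred_eq] at hj hk
    simp only [Prod.mk.injEq] at hjk
    obtain ⟨a, ha⟩ := hj
    obtain ⟨b, hb⟩ := hk
    have h2 : (j : ℕ) / l = (k : ℕ) / l := by omega
    refine Fin.ext ?_
    rw [← Nat.div_add_mod (j : ℕ) l, ← Nat.div_add_mod (k : ℕ) l, h2, hjk.2]

lemma card_alphaCells_le (m l : ℕ) (s : Fin d → ℤ) :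
    (alphaCells m l s).card ≤ m ^ d * l ^ d := by
  rw [alphaCells, Fintype.card_piFinset, ← mul_pow]
  refine (Finset.prod_le_prod' fun i _ => card_filter_even_le (s i)).trans ?_
  simp

/-- One zero-mean constraint per subcell of the `α`-cubes. The number of constraints is at most `m ^
d * l ^ d`, one less than the order of the level. -/
lemma le_level_of_order {m l : ℕ} (hm : 0 < m) (hl : 0 < l) {α β c t : ℝ} (s : Fin d → ℤ)
    (hα : 0 ≤ α) (hc0 : 0 ≤ c) (hc : c * poincareConst d ≤ 1)
    (hβ : c * ((l : ℝ) - 1) ^ 2 / (1 / (2 * (m : ℝ))) ^ 2 ≤ β)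
    (ht : t ∈ levelsAbove (periodicPotential (1 / (2 * (m : ℝ))) s α β) (m ^ d * l ^ d + 1)) :
    c * ((l : ℝ) - 1) ^ 2 / (1 / (2 * (m : ℝ))) ^ 2 ≤ t := by
  have hm' : (0 : ℝ) < m := by exact_mod_cast hm
  have hl' : (1 : ℝ) ≤ l := by exact_mod_cast hl
  set T := c * ((l : ℝ) - 1) ^ 2 / (1 / (2 * (m : ℝ))) ^ 2 with hT
  have hT0 : 0 ≤ T := by positivity
  have hV := memLp_periodicPotential (1 / (2 * (m : ℝ))) s α β
  rw [levelsAbove_eq hV] at ht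
  refine le_of_mem_levels (mulOp_sub_one_symm hV) ht (ι := alphaCells m l s) ?_
    (fun j => charL2 _ (measurableSet_cell (2 * m * l) fun i => (j.1 i : ℕ))) fun p hp => ?_
  · rw [Fintype.card_coe]
    exact Nat.lt_succ_of_le (card_alphaCells_le m l s)
  · refine form_ge_of_constraints hV (periodicPotential_nonneg s hα (hT0.trans hβ))
      (by positivity) (alphaCells m l s) hT0 ?_ (fun j hj x hx => ?_) p fun j hj => hp ⟨j, hj⟩
    · have h1 : T * (poincareConst d * (1 / ((2 * m * l : ℕ) : ℝ)) ^ 2) =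
          (c * poincareConst d) * (((l : ℝ) - 1) / l) ^ 2 := by
        rw [hT]; push_cast; field_simp
      rw [h1]
      refine mul_le_one₀ hc (sq_nonneg _) ?_
      refine pow_le_one₀ (div_nonneg (by linarith) (by linarith)) ?_
      rw [div_le_one (by linarith)]
      linarith
    · rw [periodicPotential_of_not]
      · exact hβ
      · intro h
        refine hj (Fintype.mem_piFinset.2 fun i => ?_)
        have := h i
        rw [floor_div_of_mem_cell hm hl hx] at this
        simpa using this

/-! ### Lower bound for the first eigenvalue. -/

/-- The Cauchy–Schwarz inequality against a constant. -/
lemma sq_setIntegral_le {Q : Set (Fin d → ℝ)} (hQD : Q ⊆ unitCube d) (f : L2D d) :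
    (∫ x in Q, f x) ^ 2 ≤ volume.real Q * ∫ x in Q, f x ^ 2 := by
  have hfin := measure_ne_top_of_subset_unitCube hQD
  have : IsFiniteMeasure (volume.restrict Q) := ⟨by simpa using hfin.lt_top⟩
  set v := volume.real Q with hv
  set I := ∫ x in Q, f x with hI
  have h1 : ∫ x in Q, (v * f x - I) ^ 2 = v * (v * (∫ x in Q, f x ^ 2) - I ^ 2) := by
    have h2 : ∀ x, (v * f x - I) ^ 2 = v ^ 2 * f x ^ 2 - 2 * v * I * f x + I ^ 2 :=
      fun x => by ring
    simp only [h2]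
    have h3 := (integrableOn_sq f hQD).const_mul (v ^ 2)
    have h4 := (integrableOn_L2D f hQD).const_mul (2 * v * I)
    have h5 : Integrable (fun x => v ^ 2 * f x ^ 2 - 2 * v * I * f x) (volume.restrict Q) :=
      h3.sub h4
    rw [integral_add h5 (integrable_const _), integral_sub h3 h4, integral_const_mul,
      integral_const_mul, integral_const, ← hI]
    simp [hv, measureReal_def]
    ring
  have h2 : 0 ≤ v * (v * (∫ x in Q, f x ^ 2) - I ^ 2) := h1 ▸ integral_nonneg fun x => sq_nonneg _
  rcases (measureReal_nonneg : 0 ≤ v).eq_or_lt with h0 | h0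
  · have h3 : volume Q = 0 := (measureReal_eq_zero_iff hfin).1 h0.symm
    have h4 : I = 0 := by rw [hI, Measure.restrict_eq_zero.2 h3, integral_zero_measure]
    rw [h4, hv, ← h0]; simp
  · have := nonneg_of_mul_nonneg_right h2 h0
    linarith

lemma volume_real_cell {n : ℕ} (hn : 0 < n) {j : Fin d → ℕ} (hj : ∀ i, j i < n) :
    (n : ℝ)⁻¹ ^ d ≤ volume.real (cell n j) := by
  have hn' : (0 : ℝ) < n := by exact_mod_cast hn
  have h1 : (Set.univ.pi fun i => Set.Ioo ((j i : ℝ) / n) (((j i : ℝ) + 1) / n)) ⊆ cell n j := by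
    refine Set.pi_mono fun i _ t ht => ⟨⟨?_, ?_⟩, ht.1.le, ht.2⟩
    · exact lt_of_le_of_lt (by positivity) ht.1
    · refine lt_of_lt_of_le ht.2 ?_
      rw [div_le_one hn']
      exact_mod_cast hj i
  refine le_trans (le_of_eq ?_) (measureReal_mono h1
    (measure_ne_top_of_subset_unitCube (cell_subset n j)))
  rw [measureReal_def, Real.volume_pi_Ioo, ENNReal.toReal_prod]
  have h2 : ∀ i, ((j i : ℝ) + 1) / n - (j i : ℝ) / n = (n : ℝ)⁻¹ := fun i => by ring
  simp only [h2, ENNReal.toReal_ofReal (inv_nonneg.2 hn'.le)]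
  simp

lemma volume_real_le_of_subset_cell {n : ℕ} (hn : 0 < n) {j : Fin d → ℕ} {Q : Set (Fin d → ℝ)}
    (hQ : Q ⊆ cell n j) : volume.real Q ≤ (n : ℝ)⁻¹ ^ d := by
  have hn' : (0 : ℝ) < n := by exact_mod_cast hn
  have h1 : Q ⊆ Set.univ.pi fun i => Set.Ico ((j i : ℝ) / n) (((j i : ℝ) + 1) / n) :=
    hQ.trans (Set.pi_mono fun i _ => Set.inter_subset_right)
  have h3 : volume.real (Set.univ.pi fun i => Set.Ico ((j i : ℝ) / n) (((j i : ℝ) + 1) / n)) =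
      (n : ℝ)⁻¹ ^ d := by
    rw [measureReal_def, Real.volume_pi_Ico, ENNReal.toReal_prod]
    have h2 : ∀ i, ((j i : ℝ) + 1) / n - (j i : ℝ) / n = (n : ℝ)⁻¹ := fun i => by ring
    simp only [h2, ENNReal.toReal_ofReal (inv_nonneg.2 hn'.le)]
    simp
  rw [← h3]
  refine measureReal_mono h1 ?_
  rw [Real.volume_pi_Ico]
  exact ENNReal.prod_ne_top fun i _ => ENNReal.ofReal_ne_top

/-- In a cell of width `1 / m` the `α`-region lies in a single cell of half that width. -/
lemma alpha_subset_cell {m : ℕ} (hm : 0 < m) (s : Fin d → ℤ) (j : Fin d → ℕ) :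
    ∃ a : Fin d → ℕ, cell m j ∩ {x | ∀ i, Even (⌊x i / (1 / (2 * (m : ℝ)))⌋ - s i)} ⊆
      cell (2 * m) a := by
  have hm' : (0 : ℝ) < m := by exact_mod_cast hm
  -- An interval of width `1 / m` consists of the `ε`-intervals with indices `2 j i` and `2 j i +
  -- 1`; exactly one has the parity of `s i`.
  refine ⟨fun i => 2 * j i + (s i % 2).toNat, fun x hx i _ => ?_⟩
  have hx1 := hx.1 i trivial
  refine ⟨hx1.1, ?_⟩
  have h1 := hx1.2
  have h2 := hx.2 i
  rw [one_div, div_inv_eq_mul] at h2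
  rw [Set.mem_Ico, div_le_iff₀ hm', lt_div_iff₀ hm'] at h1
  have h3 : (2 * j i : ℤ) ≤ ⌊x i * (2 * (m : ℝ))⌋ := by
    rw [Int.le_floor]; push_cast; linarith [h1.1]
  have h4 : ⌊x i * (2 * (m : ℝ))⌋ < (2 * j i + 2 : ℤ) := by
    rw [Int.floor_lt]; push_cast; linarith [h1.2]
  obtain ⟨b, hb⟩ := h2
  have h5 : ⌊x i * (2 * (m : ℝ))⌋ = ((2 * j i + (s i % 2).toNat : ℕ) : ℤ) := by
    push_cast
    omega
  rw [Int.floor_eq_iff] at h5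
  rw [Set.mem_Ico, div_le_iff₀ (by positivity), lt_div_iff₀ (by positivity)]
  push_cast at h5 ⊢
  exact ⟨h5.1, h5.2⟩

/-- Poincaré controls `u` by its mean and its gradient. As `d ≥ 1`, the `α`-part fills at most half
of the period cell, so its share of the squared mean can be absorbed on the left. What remains is
the gradient and the mass in the `β`-part, and the potential pays for the latter. -/
lemma energy_ge_on_cell (hd : 1 ≤ d) {m : ℕ} (hm : 0 < m) {α β T : ℝ} (s : Fin d → ℤ) (hα : 0 ≤ α)
    (hT0 : 0 ≤ T) (hTβ : 12 * T ≤ β) (hT : 4 * T * (poincareConst d * (1 / m) ^ 2) ≤ 1)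
    (p : H1per d) {j : Fin d → ℕ} (hj : ∀ i, j i < m) :
    T * ∫ x in cell m j, H1per.embed p x ^ 2 ≤
      energyOn (periodicPotential (1 / (2 * (m : ℝ))) s α β) p (cell m j) := by
  have hm' : (0 : ℝ) < m := by exact_mod_cast hm
  set V := periodicPotential (1 / (2 * (m : ℝ))) s α β with hVdef
  have hV : MemLp V ∞ (volume.restrict (unitCube d)) := memLp_periodicPotential _ _ _ _
  have hV0 : ∀ x, 0 ≤ V x := periodicPotential_nonneg s hα (by linarith)
  set u := H1per.embed p with hu
  set P : Set (Fin d → ℝ) := {x | ∀ i, Even (⌊x i / (1 / (2 * (m : ℝ)))⌋ - s i)} with hP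
  have hPm : MeasurableSet P := measurableSet_forall_even _ s
  set R := cell m j with hR
  have hRm : MeasurableSet R := measurableSet_cell m j
  have hRD : R ⊆ unitCube d := cell_subset m j
  have hQD : R ∩ P ⊆ unitCube d := Set.inter_subset_left.trans hRD
  have hBD : R \ P ⊆ unitCube d := Set.sdiff_subset.trans hRD
  set G := ∑ i, ∫ x in R, H1per.grad p i x ^ 2 with hG
  have hG0 : 0 ≤ G := sum_grad_nonneg p R
  set v := volume.real R with hv
  have hv0 : 0 < v := lt_of_lt_of_le (by positivity) (volume_real_cell hm hj)
  have h1 := poincare (convex_cell m j) hRm hRD abs_sub_le_of_mem_cell p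
  have h2 : ∫ x in R, u x = (∫ x in R ∩ P, u x) + ∫ x in R \ P, u x :=
    (integral_inter_add_sdiff hPm (integrableOn_L2D u hRD)).symm
  have h3 : ∫ x in R, u x ^ 2 = (∫ x in R ∩ P, u x ^ 2) + ∫ x in R \ P, u x ^ 2 :=
    (integral_inter_add_sdiff hPm (integrableOn_sq u hRD)).symm
  have hS1 : 0 ≤ ∫ x in R ∩ P, u x ^ 2 := integral_nonneg fun x => sq_nonneg _
  have hS2 : 0 ≤ ∫ x in R \ P, u x ^ 2 := integral_nonneg fun x => sq_nonneg _
  have hQv : volume.real (R ∩ P) ≤ 1 / 2 * v := by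
    obtain ⟨a, ha⟩ := alpha_subset_cell hm s j
    refine (volume_real_le_of_subset_cell (by positivity) ha).trans ?_
    refine le_trans ?_ (mul_le_mul_of_nonneg_left (volume_real_cell hm hj) (by norm_num))
    push_cast
    rw [mul_inv, mul_pow]
    refine mul_le_mul_of_nonneg_right ?_ (by positivity)
    calc ((2 : ℝ)⁻¹) ^ d ≤ 2⁻¹ ^ 1 := pow_le_pow_of_le_one (by norm_num) (by norm_num) hd
      _ = 1 / 2 := by norm_num
  have hBv : volume.real (R \ P) ≤ v := measureReal_mono Set.sdiff_subset
    (measure_ne_top_of_subset_unitCube hRD)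
  have h4 : (∫ x in R ∩ P, u x) ^ 2 ≤ 1 / 2 * v * ∫ x in R ∩ P, u x ^ 2 :=
    (sq_setIntegral_le hQD u).trans (mul_le_mul_of_nonneg_right hQv hS1)
  have h5 : (∫ x in R \ P, u x) ^ 2 ≤ v * ∫ x in R \ P, u x ^ 2 :=
    (sq_setIntegral_le hBD u).trans (mul_le_mul_of_nonneg_right hBv hS2)
  -- The weights are chosen so that `3/2 · 1/2 = 3/4 < 1`. Absorbing `3/4` of the mass multiplies
  -- the remaining terms by `4`, hence the constants `12` and `4`.
  have h6 : (∫ x in R, u x) ^ 2 ≤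
      3 / 2 * (∫ x in R ∩ P, u x) ^ 2 + 3 * (∫ x in R \ P, u x) ^ 2 := by
    rw [h2]
    nlinarith [sq_nonneg ((∫ x in R ∩ P, u x) - 2 * ∫ x in R \ P, u x)]
  have h7 : ∫ x in R, u x ^ 2 ≤ 12 * (∫ x in R \ P, u x ^ 2) +
      4 * (poincareConst d * (1 / m) ^ 2) * G := by
    refine le_of_mul_le_mul_left ?_ hv0
    have h8 : v * ∫ x in R, u x ^ 2 = v * (∫ x in R ∩ P, u x ^ 2) + v * ∫ x in R \ P, u x ^ 2 := by
      rw [h3, mul_add]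
    have h9 : 0 ≤ v * ∫ x in R \ P, u x ^ 2 := mul_nonneg hv0.le hS2
    linarith
  have h8 : β * ∫ x in R \ P, u x ^ 2 ≤ ∫ x in R, V x * u x ^ 2 := by
    refine (mul_integral_sq_le_of_le (hRm.diff hPm) hBD hV (fun x hx => ?_) u).trans ?_
    · rw [hVdef, periodicPotential_of_not hx.2]
    · exact setIntegral_mono_set (integrableOn_mul_sq hV u hRD)
        (Eventually.of_forall fun x => mul_nonneg (hV0 x) (sq_nonneg _))
        Set.sdiff_subset.eventuallyLE
  rw [energyOn, ← hG]
  have h9 : T * ∫ x in R, u x ^ 2 ≤ T * (12 * (∫ x in R \ P, u x ^ 2) +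
      4 * (poincareConst d * (1 / m) ^ 2) * G) := mul_le_mul_of_nonneg_left h7 hT0
  have h10 := mul_le_mul_of_nonneg_right hTβ hS2
  have h11 := mul_le_mul_of_nonneg_right hT hG0
  linarith

/-- For the first level no constraint is allowed, hence the empty index type; the cellwise bound is
summed over the `m ^ d` period cells. -/
lemma le_level_one (hd : 1 ≤ d) {m : ℕ} (hm : 0 < m) {α β T t : ℝ} (s : Fin d → ℤ) (hα : 0 ≤ α)
    (hT0 : 0 ≤ T) (hTβ : 12 * T ≤ β) (hT : 4 * T * (poincareConst d * (1 / m) ^ 2) ≤ 1)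
    (ht : t ∈ levelsAbove (periodicPotential (1 / (2 * (m : ℝ))) s α β) 1) : T ≤ t := by
  have hV := memLp_periodicPotential (1 / (2 * (m : ℝ))) s α β
  rw [levelsAbove_eq hV] at ht
  refine le_of_mem_levels (mulOp_sub_one_symm hV) ht (ι := Empty) (by simp) (fun i => i.elim)
    fun p _ => ?_
  exact energy_ge_of_cells hV hm p fun j =>
    energy_ge_on_cell hd hm s hα hT0 hTβ hT p fun i => (j i).2

end SchroedingerPer

/-! ### Test functions and upper bounds -/

namespace CompactForm

open scoped InnerProductSpace

variable {E X : Type*} [NormedAddCommGroup E] [InnerProductSpace ℝ E]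
  [NormedAddCommGroup X] [InnerProductSpace ℝ X] {J : E →L[ℝ] X} {M : X →L[ℝ] X}

/-- Mutually orthogonal test vectors with small Rayleigh quotients. -/
lemma mem_levels_of_orthogonal [CompleteSpace E] (hJ : IsCompactOperator J)
    (hM : ∀ x y, ⟪M x, y⟫_ℝ = ⟪x, M y⟫_ℝ) {ι : Type*} [Fintype ι] (u : ι → E)
    (h0 : ∀ i, J (u i) ≠ 0) (horth : ∀ i j, i ≠ j → ⟪J (u i), J (u j)⟫_ℝ = 0)
    (hform : ∀ i j, i ≠ j → form J M (u i) (u j) = 0) {t : ℝ}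
    (ht : ∀ i, form J M (u i) (u i) ≤ t * ‖J (u i)‖ ^ 2) :
    t ∈ levels J M (Fintype.card ι) := by
  classical
  refine mem_levels hJ hM u (linearIndependent_of_ne_zero_of_inner_eq_zero h0
    fun i j hij => horth i j hij) fun c => ?_
  have h1 : form J M (∑ i, c i • u i) (∑ i, c i • u i) = ∑ i, c i ^ 2 * form J M (u i) (u i) := by
    simp only [map_sum, map_smul, LinearMap.sum_apply, LinearMap.smul_apply, smul_eq_mul]
    refine Finset.sum_congr rfl fun i _ => ?_
    rw [Finset.sum_eq_single i (fun j _ hji => by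
      rw [hform j i hji]
      simp) (by simp)]
    ring
  have h2 : ‖J (∑ i, c i • u i)‖ ^ 2 = ∑ i, c i ^ 2 * ‖J (u i)‖ ^ 2 := by
    simp only [← real_inner_self_eq_norm_sq, map_sum, map_smul, sum_inner, inner_smul_left]
    refine Finset.sum_congr rfl fun i _ => ?_
    rw [inner_sum, Finset.sum_eq_single i (fun j _ hji => by
      rw [inner_smul_right, horth i j hji.symm, mul_zero]) (by simp), inner_smul_right]
    simp; ring
  rw [h1, h2, Finset.mul_sum]
  refine Finset.sum_le_sum fun i _ => ?_
  nlinarith [mul_le_mul_of_nonneg_left (ht i) (sq_nonneg (c i))]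

end CompactForm

namespace SchroedingerPer

open scoped InnerProductSpace ENNReal
open Filter Topology CompactForm

variable {d : ℕ}

lemma contDiff_continuous_fderiv {f : (Fin d → ℝ) → ℝ} (hf : ContDiff ℝ ∞ f) (v : Fin d → ℝ) :
    Continuous fun x => fderiv ℝ f x v :=
  (hf.continuous_fderiv (by simp)).clm_apply continuous_const

lemma setIntegral_unitCube_eq {f : (Fin d → ℝ) → ℝ} (hf : Function.support f ⊆ unitCube d) :
    ∫ x in unitCube d, f x = ∫ x, f x :=
  setIntegral_eq_integral_of_forall_compl_eq_zero fun x hx => by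
    by_contra h
    exact hx (hf h)

lemma support_fderiv_apply_subset (f : (Fin d → ℝ) → ℝ) (v : Fin d → ℝ) :
    Function.support (fun x => fderiv ℝ f x v) ⊆ tsupport f := by
  refine subset_trans (fun x hx => ?_) (support_fderiv_subset ℝ (f := f))
  intro h
  exact hx (by simp [h])

/-- Classical gradients of functions with compact support in the cube are weak gradients. -/
lemma isPeriodicWeakGradient_toL2 {f : (Fin d → ℝ) → ℝ} (hf : ContDiff ℝ ∞ f)
    (hc : HasCompactSupport f) (hs : tsupport f ⊆ unitCube d) :
    IsPeriodicWeakGradient (toL2 f hf.continuous)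
      fun i => toL2 _ (contDiff_continuous_fderiv hf (Pi.single i 1)) := by
  intro φ hφ i
  set v : Fin d → ℝ := Pi.single i 1
  have h1 : ∫ x in unitCube d, toL2 f hf.continuous x * fderiv ℝ φ x v =
      ∫ x, f x * fderiv ℝ φ x v := by
    rw [← setIntegral_unitCube_eq]
    · refine integral_congr_ae ?_
      filter_upwards [coeFn_toL2 f hf.continuous] with x hx
      rw [hx]
    · exact (Function.support_mul_subset_left _ _).trans ((subset_tsupport f).trans hs)
  have h2 : ∫ x in unitCube d, toL2 _ (contDiff_continuous_fderiv hf v) x * φ x =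
      ∫ x, fderiv ℝ f x v * φ x := by
    rw [← setIntegral_unitCube_eq]
    · refine integral_congr_ae ?_
      filter_upwards [coeFn_toL2 _ (contDiff_continuous_fderiv hf v)] with x hx
      rw [hx]
    · exact (Function.support_mul_subset_left _ _).trans
        ((support_fderiv_apply_subset f v).trans hs)
  rw [h1, h2]
  have hcd : HasCompactSupport fun x => fderiv ℝ f x v :=
    HasCompactSupport.of_support_subset_isCompact hc (support_fderiv_apply_subset f v)
  refine integral_mul_fderiv_eq_neg_fderiv_mul_of_integrable ?_ ?_ ?_
    (fun x _ => hf.differentiable (by simp) x) (fun x _ => hφ.1.differentiable (by simp) x)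
  · exact ((contDiff_continuous_fderiv hf v).mul hφ.continuous).integrable_of_hasCompactSupport
      hcd.mul_right
  · exact (hf.continuous.mul (hφ.continuous_fderiv v)).integrable_of_hasCompactSupport hc.mul_right
  · exact (hf.continuous.mul hφ.continuous).integrable_of_hasCompactSupport hc.mul_right

lemma inner_toL2 {f g : (Fin d → ℝ) → ℝ} (hf : Continuous f) (hg : Continuous g) :
    ⟪toL2 f hf, toL2 g hg⟫_ℝ = ∫ x in unitCube d, f x * g x := by
  rw [inner_L2D]
  refine integral_congr_ae ?_
  filter_upwards [coeFn_toL2 f hf, coeFn_toL2 g hg] with x h1 h2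
  rw [h1, h2]

lemma inner_mulOp_toL2 {V : (Fin d → ℝ) → ℝ} (hV : MemLp V ∞ (volume.restrict (unitCube d)))
    {f g : (Fin d → ℝ) → ℝ} (hf : Continuous f) (hg : Continuous g) :
    ⟪mulOp V hV (toL2 f hf), toL2 g hg⟫_ℝ = ∫ x in unitCube d, V x * f x * g x := by
  rw [inner_mulOp_left]
  refine integral_congr_ae ?_
  filter_upwards [coeFn_toL2 f hf, coeFn_toL2 g hg] with x h1 h2
  rw [h1, h2]

lemma exists_bump (d : ℕ) : ∃ ψ : (Fin d → ℝ) → ℝ, ContDiff ℝ ∞ ψ ∧ HasCompactSupport ψ ∧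
    tsupport ψ ⊆ unitCube d ∧ 0 < ∫ x, ψ x ^ 2 := by
  let b : ContDiffBump (fun _ : Fin d => (1 / 2 : ℝ)) := ⟨1 / 8, 1 / 4, by norm_num, by norm_num⟩
  refine ⟨b, b.contDiff, b.hasCompactSupport, ?_, ?_⟩
  · rw [b.tsupport_eq]
    intro x hx i _
    have h1 : dist (x i) (1 / 2) ≤ 1 / 4 := (dist_le_pi_dist x _ i).trans hx
    rw [Real.dist_eq, abs_le] at h1
    constructor <;> linarith [h1.1, h1.2]
  · refine Continuous.integral_pos_of_hasCompactSupport_nonneg_nonzero (x := fun _ => 1 / 2)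
      (b.continuous.pow 2) ?_ (fun x => sq_nonneg _) ?_
    · exact b.hasCompactSupport.comp_left (g := fun t => t ^ 2) (by simp)
    · have : b (fun _ => 1 / 2) = 1 := b.one_of_mem_closedBall (by simp [b])
      rw [this]; norm_num

/-! ### Rescaled bumps as test functions. -/

/-- The copy of `ψ` in the cell with index `j` of the mesh of width `1 / n`. -/
def cellCopy (ψ : (Fin d → ℝ) → ℝ) (n : ℕ) (j : Fin d → ℕ) (x : Fin d → ℝ) : ℝ :=
  ψ ((n : ℝ) • x - fun i => (j i : ℝ))

section CellCopy

variable {ψ : (Fin d → ℝ) → ℝ} {n : ℕ} {j : Fin d → ℕ}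

lemma contDiff_cellCopy (hψ : ContDiff ℝ ∞ ψ) : ContDiff ℝ ∞ (cellCopy ψ n j) :=
  hψ.comp ((contDiff_id.const_smul (n : ℝ)).sub contDiff_const)

lemma fderiv_cellCopy (hψ : ContDiff ℝ ∞ ψ) (x v : Fin d → ℝ) :
    fderiv ℝ (cellCopy ψ n j) x v = n * fderiv ℝ ψ ((n : ℝ) • x - fun i => (j i : ℝ)) v := by
  have h1 : HasFDerivAt (fun x : Fin d → ℝ => (n : ℝ) • x - fun i => (j i : ℝ))
      ((n : ℝ) • ContinuousLinearMap.id ℝ (Fin d → ℝ)) x :=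
    ((hasFDerivAt_id x).const_smul (n : ℝ)).sub_const _
  have h2 := ((hψ.differentiable (by simp) _).hasFDerivAt (x := (n : ℝ) • x -
    fun i => (j i : ℝ))).comp x h1
  have h3 : fderiv ℝ (cellCopy ψ n j) x = _ := h2.fderiv
  rw [h3]
  simp

/-- The support of `ψ` is compact in the open cube, so its rescaling is compact inside the cell.
Closed supports in different cells are therefore disjoint, and no boundary terms arise. -/
lemma exists_compact_cellCopy (hn : 0 < n) (hj : ∀ i, j i < n) (hc : HasCompactSupport ψ)
    (hs : tsupport ψ ⊆ unitCube d) :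
    ∃ K ⊆ cell n j, IsCompact K ∧ ∀ x, (n : ℝ) • x - (fun i => (j i : ℝ)) ∈ tsupport ψ → x ∈ K := by
  have hn' : (0 : ℝ) < n := by exact_mod_cast hn
  refine ⟨(fun y : Fin d → ℝ => (n : ℝ)⁻¹ • (y + fun i => (j i : ℝ))) '' tsupport ψ, ?_,
    hc.isCompact.image (by fun_prop), fun x hx => ⟨_, hx, ?_⟩⟩
  · rintro _ ⟨y, hy, rfl⟩ i _
    have hy1 := hs hy i trivial
    have hj1 : (j i : ℝ) + 1 ≤ n := by exact_mod_cast hj i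
    have hj0 : (0 : ℝ) ≤ j i := Nat.cast_nonneg _
    have h1 : ((n : ℝ)⁻¹ • (y + fun i => (j i : ℝ))) i = (y i + j i) / n := by
      simp [div_eq_inv_mul]
    simp only [h1]
    refine ⟨⟨div_pos (by linarith [hy1.1]) hn', ?_⟩, ?_, ?_⟩
    · rw [div_lt_one hn']; linarith [hy1.2]
    · exact div_le_div_of_nonneg_right (by linarith [hy1.1]) hn'.le
    · exact div_lt_div_of_pos_right (by linarith [hy1.2]) hn'
  · simp only [sub_add_cancel]
    rw [smul_smul, inv_mul_cancel₀ hn'.ne', one_smul]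

lemma integral_comp_cell (F : (Fin d → ℝ) → ℝ) :
    ∫ x, F ((n : ℝ) • x - fun i => (j i : ℝ)) = ((n : ℝ) ^ d)⁻¹ * ∫ x, F x := by
  have h1 := Measure.integral_comp_smul volume (fun y => F (y - fun i => (j i : ℝ))) (n : ℝ)
  rw [h1, integral_sub_right_eq_self F]
  simp

variable (hψ : ContDiff ℝ ∞ ψ) (hc : HasCompactSupport ψ) (hs : tsupport ψ ⊆ unitCube d)
  (hn : 0 < n) (hj : ∀ i, j i < n)

include hc hs hn hj

lemma tsupport_cellCopy : tsupport (cellCopy ψ n j) ⊆ cell n j ∧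
    HasCompactSupport (cellCopy ψ n j) := by
  obtain ⟨K, hK, hKc, hKx⟩ := exists_compact_cellCopy hn hj hc hs
  have h1 : tsupport (cellCopy ψ n j) ⊆ K :=
    closure_minimal (fun x hx => hKx x (subset_tsupport ψ hx)) hKc.isClosed
  exact ⟨h1.trans hK, hKc.of_isClosed_subset (isClosed_tsupport _) h1⟩

include hψ

lemma isPeriodicWeakGradient_cellCopy :
    IsPeriodicWeakGradient (toL2 _ (contDiff_cellCopy (n := n) (j := j) hψ).continuous)
      fun i => toL2 _ (contDiff_continuous_fderiv (contDiff_cellCopy (n := n) (j := j) hψ)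
        (Pi.single i 1)) :=
  isPeriodicWeakGradient_toL2 (contDiff_cellCopy hψ) (tsupport_cellCopy hc hs hn hj).2
    ((tsupport_cellCopy hc hs hn hj).1.trans (cell_subset n j))

/-- The copy of `ψ` in a cell as an element of `H¹_per(D)`. -/
noncomputable def cellTest : H1per d :=
  H1per.mk _ _ (isPeriodicWeakGradient_cellCopy hψ hc hs hn hj)

lemma norm_sq_cellTest :
    ‖H1per.embed (cellTest hψ hc hs hn hj)‖ ^ 2 = ((n : ℝ) ^ d)⁻¹ * ∫ x, ψ x ^ 2 := by
  have h0 := tsupport_cellCopy hc hs hn hj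
  rw [← real_inner_self_eq_norm_sq, cellTest, H1per.embed_mk, inner_toL2, setIntegral_unitCube_eq]
  · rw [← integral_comp_cell (n := n) (j := j) fun x => ψ x ^ 2]
    simp only [cellCopy, pow_two]
  · exact (Function.support_mul_subset_left _ _).trans
      ((subset_tsupport _).trans (h0.1.trans (cell_subset n j)))

/-- Rescaling contributes `n²` from the two gradients and `n ^ (-d)` from the volume. The potential
is seen only through its constant value on the cell. -/
lemma form_cellTest_self {V : (Fin d → ℝ) → ℝ} (hV : MemLp V ∞ (volume.restrict (unitCube d)))
    {α : ℝ} (hα : ∀ x ∈ cell n j, V x = α) :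
    form H1per.embed (mulOp V hV - 1) (cellTest hψ hc hs hn hj) (cellTest hψ hc hs hn hj) =
      (n : ℝ) ^ 2 * (((n : ℝ) ^ d)⁻¹ * ∫ x, gradSq ψ x) +
        α * ‖H1per.embed (cellTest hψ hc hs hn hj)‖ ^ 2 := by
  have h0 := tsupport_cellCopy hc hs hn hj
  have h0D := h0.1.trans (cell_subset n j)
  rw [form_H1per, norm_sq_cellTest hψ hc hs hn hj, ← integral_comp_cell (n := n) (j := j),
    ← integral_comp_cell (n := n) (j := j)]
  simp only [cellTest, H1per.embed_mk, H1per.grad_mk, inner_mulOp_toL2, inner_toL2]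
  congr 1
  · rw [← integral_finsetSum]
    · rw [setIntegral_unitCube_eq, ← integral_const_mul]
      · refine integral_congr_ae (Eventually.of_forall fun x => ?_)
        simp only [fderiv_cellCopy hψ, gradSq, Finset.mul_sum]
        exact Finset.sum_congr rfl fun i _ => by ring
      · intro x hx
        obtain ⟨i, -, hi⟩ := Finset.exists_ne_zero_of_sum_ne_zero hx
        exact h0D (support_fderiv_apply_subset _ _ (left_ne_zero_of_mul hi))
    · intro i _
      exact memLp_one_iff_integrable.1 (memLp_of_continuous
        ((contDiff_continuous_fderiv (contDiff_cellCopy hψ) _).mul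
          (contDiff_continuous_fderiv (contDiff_cellCopy hψ) _)) 1)
  · rw [setIntegral_unitCube_eq, ← integral_const_mul]
    · refine integral_congr_ae (Eventually.of_forall fun x => ?_)
      by_cases hx : cellCopy ψ n j x = 0
      · have hx' : ψ ((n : ℝ) • x - fun i => (j i : ℝ)) = 0 := hx
        simp [hx, hx']
      · have h1 := hα x (h0.1 (subset_tsupport _ hx))
        simp only [h1, cellCopy]
        ring
    · intro x hx
      exact h0D (subset_tsupport _ (right_ne_zero_of_mul hx))

lemma cellTest_orthogonal {k : Fin d → ℕ} (hk : ∀ i, k i < n) (hjk : j ≠ k)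
    {V : (Fin d → ℝ) → ℝ} (hV : MemLp V ∞ (volume.restrict (unitCube d))) :
    ⟪H1per.embed (cellTest hψ hc hs hn hj), H1per.embed (cellTest hψ hc hs hn hk)⟫_ℝ = 0 ∧
      form H1per.embed (mulOp V hV - 1) (cellTest hψ hc hs hn hj) (cellTest hψ hc hs hn hk) = 0 := by
  have hd1 : ∀ x, x ∈ tsupport (cellCopy ψ n j) → x ∈ tsupport (cellCopy ψ n k) → False :=
    fun x h1 h2 => Set.disjoint_left.1 (disjoint_cell hn hjk)
      ((tsupport_cellCopy hc hs hn hj).1 h1) ((tsupport_cellCopy hc hs hn hk).1 h2)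
  have h1 : ∀ x, cellCopy ψ n j x * cellCopy ψ n k x = 0 := fun x => by
    by_contra h
    exact hd1 x (subset_tsupport _ (left_ne_zero_of_mul h))
      (subset_tsupport _ (right_ne_zero_of_mul h))
  have h2 : ∀ x v, fderiv ℝ (cellCopy ψ n j) x v * fderiv ℝ (cellCopy ψ n k) x v = 0 :=
    fun x v => by
    by_contra h
    exact hd1 x (support_fderiv_apply_subset _ v (left_ne_zero_of_mul h))
      (support_fderiv_apply_subset _ v (right_ne_zero_of_mul h))
  rw [form_H1per]
  simp only [cellTest, H1per.embed_mk, H1per.grad_mk, inner_mulOp_toL2, inner_toL2, mul_assoc, h1,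
    h2, mul_zero, integral_zero, Finset.sum_const_zero, add_zero, and_self]

end CellCopy

/-- The index of the `r`-th diagonal subcell of order `l` of the `z`-th `α`-cube. -/
def diagIndex (l : ℕ) (s : Fin d → ℤ) (z : Fin d → ℕ) (r : ℕ) (i : Fin d) : ℕ :=
  l * (2 * z i + (s i % 2).toNat) + r

lemma diagIndex_lt {m l : ℕ} (s : Fin d → ℤ) (z : Fin d → Fin m) (r : Fin l) (i : Fin d) :
    diagIndex l s (fun i => (z i : ℕ)) r i < 2 * m * l := by
  have h1 : 2 * (z i : ℕ) + (s i % 2).toNat + 1 ≤ 2 * m := by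
    have := (z i).2
    omega
  have h2 := r.2
  have h3 := Nat.mul_le_mul_left l h1
  unfold diagIndex
  linarith

lemma diagIndex_div {l : ℕ} (s : Fin d → ℤ) (z : Fin d → ℕ) (r : Fin l) (i : Fin d) :
    diagIndex l s z r i / l = 2 * z i + (s i % 2).toNat := by
  have hl : 0 < l := r.pos
  rw [diagIndex, Nat.mul_add_div hl, Nat.div_eq_of_lt r.2, add_zero]

/-- Division by `l` recovers `z`; the remaining offset `r` is then read from one coordinate, which
exists because `d ≥ 1`. -/
lemma diagIndex_injective (hd : 1 ≤ d) {m l : ℕ} (s : Fin d → ℤ) :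
    Function.Injective fun q : (Fin d → Fin m) × Fin l =>
      diagIndex l s (fun i => (q.1 i : ℕ)) q.2 := by
  rintro ⟨z, r⟩ ⟨z', r'⟩ h
  simp only at h
  have h1 : z = z' := by
    funext i
    have h2 := congrArg (· / l) (congrFun h i)
    simp only [diagIndex_div] at h2
    exact Fin.ext (by omega)
  subst h1
  have h3 := congrFun h ⟨0, hd⟩
  simp only [diagIndex] at h3
  rw [Prod.mk.injEq]
  exact ⟨rfl, Fin.ext (by omega)⟩

/-- The `l` diagonal subcells of each of the `m ^ d` `α`-cubes carry disjoint copies of one bump.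
The constant depends only on the Rayleigh quotient of that bump, raised by `1` to be positive. -/
lemma exists_mem_levelsAbove (hd : 1 ≤ d) : ∃ κ : ℝ, 0 < κ ∧ ∀ (m l : ℕ) (s : Fin d → ℤ) (α β : ℝ),
    0 < m → 0 < l → κ * (2 * m * l : ℝ) ^ 2 + α ∈
      levelsAbove (periodicPotential (1 / (2 * (m : ℝ))) s α β) (m ^ d * l) := by
  obtain ⟨ψ, hψ, hc, hs, hpos⟩ := exists_bump d
  set κ := (∫ x, gradSq ψ x) / ∫ x, ψ x ^ 2 with hκ
  have hG0 : 0 ≤ ∫ x, gradSq ψ x := integral_nonneg fun x => gradSq_nonneg _ _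
  have hκ0 : 0 ≤ κ := div_nonneg hG0 hpos.le
  refine ⟨κ + 1, by linarith, fun m l s α β hm hl => ?_⟩
  have hn : 0 < 2 * m * l := by positivity
  have hn' : (0 : ℝ) < ((2 * m * l : ℕ) : ℝ) := by exact_mod_cast hn
  have hV := memLp_periodicPotential (1 / (2 * (m : ℝ))) s α β
  rw [levelsAbove_eq hV]
  have hcard : m ^ d * l = Fintype.card ((Fin d → Fin m) × Fin l) := by simp
  rw [hcard]
  have hcell : ∀ q : (Fin d → Fin m) × Fin l,
      ∀ x ∈ cell (2 * m * l) (diagIndex l s (fun i => (q.1 i : ℕ)) q.2),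
        periodicPotential (1 / (2 * (m : ℝ))) s α β x = α := by
    intro q x hx
    refine periodicPotential_of_forall fun i => ?_
    rw [floor_div_of_mem_cell hm hl hx, diagIndex_div]
    push_cast
    rw [Int.even_iff]
    omega
  refine mem_levels_of_orthogonal isCompactOperator_embed (mulOp_sub_one_symm hV)
    (fun q : (Fin d → Fin m) × Fin l => cellTest hψ hc hs hn (diagIndex_lt s q.1 q.2))
    (fun q h0 => ?_) (fun q q' hq => ?_) (fun q q' hq => ?_) (fun q => ?_)
  · have h1 := norm_sq_cellTest hψ hc hs hn (diagIndex_lt s q.1 q.2)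
    rw [h0, norm_zero] at h1
    have h2 : 0 < (((2 * m * l : ℕ) : ℝ) ^ d)⁻¹ * ∫ x, ψ x ^ 2 := by positivity
    rw [← h1] at h2
    norm_num at h2
  · exact (cellTest_orthogonal hψ hc hs hn _ _ (fun h => hq (diagIndex_injective hd s h)) hV).1
  · exact (cellTest_orthogonal hψ hc hs hn _ _ (fun h => hq (diagIndex_injective hd s h)) hV).2
  · rw [form_cellTest_self hψ hc hs hn _ hV (hcell q), norm_sq_cellTest, add_mul]
    refine add_le_add ?_ le_rfl
    have h1 : ∫ x, gradSq ψ x = κ * ∫ x, ψ x ^ 2 := by rw [hκ]; field_simp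
    rw [h1]
    have h2 : 0 ≤ (2 * m * l : ℝ) ^ 2 * ((((2 * m * l : ℕ) : ℝ) ^ d)⁻¹ * ∫ x, ψ x ^ 2) := by
      positivity
    push_cast at h2 ⊢
    linarith

end SchroedingerPer

/-! ### Estimates for the eigenvalues -/

namespace SchroedingerPer

open CompactForm

variable {d : ℕ} {ε : ℝ} {N : ℕ} {α β : ℝ}

/-- The test functions with `l = k` provide `m ^ d * k ≥ k` independent eigenfunctions, so the set
of levels is nonempty. -/
lemma isLeast_eigenvalue (hd : 1 ≤ d) (s : Fin d → ℤ) (h : IsPeriodicSetting d ε N α β) {k : ℕ}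
    (hk : 1 ≤ k) : IsLeast (levelsAbove (periodicPotential ε s α β) k)
      (eigenvalue (periodicPotential ε s α β) k) := by
  obtain ⟨m, hm, rfl, -⟩ := h.exists_nat
  have hV := memLp_periodicPotential (1 / (2 * (m : ℝ))) s α β
  obtain ⟨κ, -, hκ⟩ := exists_mem_levelsAbove hd
  have h1 := hκ m k s α β hm hk
  rw [eigenvalue]
  rw [levelsAbove_eq hV] at h1 ⊢
  exact isLeast_levels (mulOp_sub_one_symm hV)
    (exists_constraints hV (periodicPotential_nonneg s h.alpha_nonneg h.beta_nonneg)) hk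
    ⟨_, levels_antitone (Nat.le_mul_of_pos_left k (by positivity)) h1⟩

lemma IsPeriodicSetting.eps_pos (h : IsPeriodicSetting d ε N α β) : 0 < ε := by
  obtain ⟨m, hm, rfl, -⟩ := h.exists_nat
  positivity

lemma IsPeriodicSetting.one_le_card (h : IsPeriodicSetting d ε N α β) : 1 ≤ N := by
  obtain ⟨m, hm, -, rfl⟩ := h.exists_nat
  exact Nat.one_le_pow _ _ hm

lemma exists_eigenvalue_lower_bound (hd : 1 ≤ d) {cβ : ℝ} (hcβ : 0 < cβ) : ∃ c : ℝ, 0 < c ∧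
    ∀ (ε : ℝ) (N : ℕ) (α β : ℝ) (s : Fin d → ℤ), IsPeriodicSetting d ε N α β →
    ∀ l : ℕ, 1 ≤ l → cβ * ((l : ℝ) - 1) ^ 2 / ε ^ 2 ≤ β →
      c * ((l : ℝ) - 1) ^ 2 / ε ^ 2 ≤
        eigenvalue (periodicPotential ε s α β) (N * l ^ d + 1) := by
  have hC := poincareConst_nonneg (d := d)
  -- The first entry keeps the bound below `β`, the second makes the product with the Poincaré
  -- constant at most one; the `+ 1` excludes a zero denominator.
  refine ⟨min cβ (1 / (poincareConst d + 1)), by positivity, ?_⟩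
  intro ε N α β s h l hl hβ
  have h1 := (isLeast_eigenvalue hd s h (Nat.le_add_left 1 (N * l ^ d))).1
  have hα := h.alpha_nonneg
  obtain ⟨m, hm, rfl, rfl⟩ := h.exists_nat
  refine le_level_of_order hm hl s hα (by positivity) ?_ ?_ h1
  · refine (mul_le_mul_of_nonneg_right (min_le_right _ _) hC).trans ?_
    rw [one_div, inv_mul_le_one₀ (by positivity)]
    linarith
  · refine le_trans ?_ hβ
    gcongr
    exact min_le_left _ _

lemma exists_eigenvalue_upper_bound (hd : 1 ≤ d) {cα : ℝ} (hcα : 0 < cα) : ∃ C : ℝ, 0 < C ∧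
    ∀ (ε : ℝ) (N : ℕ) (α β : ℝ) (s : Fin d → ℤ), IsPeriodicSetting d ε N α β →
    α ≤ cα / ε ^ 2 → ∀ l : ℕ, 1 ≤ l →
      eigenvalue (periodicPotential ε s α β) (N * l) ≤ C * (l : ℝ) ^ 2 / ε ^ 2 := by
  obtain ⟨κ, hκ0, hκ⟩ := exists_mem_levelsAbove hd
  refine ⟨κ + cα, by positivity, ?_⟩
  intro ε N α β s h hα l hl
  have hN := h.one_le_card
  have h1 := (isLeast_eigenvalue hd s h (Nat.mul_pos hN hl)).2
  obtain ⟨m, hm, rfl, rfl⟩ := h.exists_nat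
  refine (h1 (hκ m l s α β hm hl)).trans ?_
  have hm' : (0 : ℝ) < m := by exact_mod_cast hm
  have hl' : (1 : ℝ) ≤ l := by exact_mod_cast hl
  have h2 : cα / (1 / (2 * (m : ℝ))) ^ 2 ≤ cα * (l : ℝ) ^ 2 / (1 / (2 * (m : ℝ))) ^ 2 := by
    gcongr
    exact le_mul_of_one_le_right hcα.le (one_le_pow₀ hl')
  have h3 : κ * (2 * m * l : ℝ) ^ 2 = κ * (l : ℝ) ^ 2 / (1 / (2 * (m : ℝ))) ^ 2 := by
    field_simp
  rw [h3, add_mul, add_div]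
  linarith

lemma exists_eigenvalue_one_lower_bound (hd : 1 ≤ d) {cβ : ℝ} (hcβ : 0 < cβ) : ∃ c : ℝ, 0 < c ∧
    ∀ (ε : ℝ) (N : ℕ) (α β : ℝ) (s : Fin d → ℤ), IsPeriodicSetting d ε N α β →
    cβ / ε ^ 2 ≤ β → c / ε ^ 2 ≤ eigenvalue (periodicPotential ε s α β) 1 := by
  have hC := poincareConst_nonneg (d := d)
  -- The `12` is the factor required by `energy_ge_on_cell`. The `16` is its factor `4` times `(1 /
  -- m)² / ε² = 4`, since a period cell has side `2ε`.
  refine ⟨min (cβ / 12) (1 / (16 * poincareConst d + 1)), by positivity, ?_⟩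
  set c := min (cβ / 12) (1 / (16 * poincareConst d + 1)) with hc
  have hc0 : 0 < c := by positivity
  intro ε N α β s h hβ
  have h1 := (isLeast_eigenvalue hd s h le_rfl).1
  have hα := h.alpha_nonneg
  obtain ⟨m, hm, rfl, rfl⟩ := h.exists_nat
  have hm' : (0 : ℝ) < m := by exact_mod_cast hm
  refine le_level_one hd hm s hα (by positivity) ?_ ?_ h1
  · refine le_trans ?_ hβ
    rw [← mul_div_assoc]
    gcongr
    linarith [min_le_left (cβ / 12) (1 / (16 * poincareConst d + 1))]
  · have h2 : 4 * (c / (1 / (2 * (m : ℝ))) ^ 2) * (poincareConst d * (1 / m) ^ 2) =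
        c * (16 * poincareConst d) := by
      field_simp
      ring
    rw [h2]
    refine (mul_le_mul_of_nonneg_right (min_le_right _ _) (by positivity)).trans ?_
    rw [one_div, inv_mul_le_one₀ (by positivity)]
    linarith

lemma eigenvalue_one_le (hd : 1 ≤ d) (s : Fin d → ℤ) (h : IsPeriodicSetting d ε N α β) :
    eigenvalue (periodicPotential ε s α β) 1 ≤ eigenvalue (periodicPotential ε s α β) N := by
  refine (isLeast_eigenvalue hd s h le_rfl).2 ?_
  have h1 := (isLeast_eigenvalue hd s h h.one_le_card).1
  rw [levelsAbove_eq (memLp_periodicPotential ε s α β)] at h1 ⊢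
  exact levels_antitone h.one_le_card h1

/-- Upper bound for a ratio of scaled quantities. -/
lemma div_le_div_of_scaled {x y a b c C ε : ℝ} (hε : 0 < ε) (hb : 0 < b) (hc : 0 < c)
    (hC : 0 < C) (ha : 0 ≤ a) (hx : x ≤ C * a / ε ^ 2) (hy : c * b / ε ^ 2 ≤ y) :
    x / y ≤ C / c * a / b := by
  have h1 : 0 < c * b / ε ^ 2 := by positivity
  calc x / y ≤ (C * a / ε ^ 2) / y := div_le_div_of_nonneg_right hx (h1.le.trans hy)
    _ ≤ (C * a / ε ^ 2) / (c * b / ε ^ 2) := div_le_div_of_nonneg_left (by positivity) h1 hy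
    _ = C / c * a / b := by field_simp

end SchroedingerPer

theorem mainTheorem5 (d : ℕ) (hd : 1 ≤ d) :
    -- the eigenvalues `E^k`, `k ≥ 1`, exist: the infimum defining `E^k` is attained
    (∀ (ε : ℝ) (N : ℕ) (α β : ℝ) (s : Fin d → ℤ), IsPeriodicSetting d ε N α β →
      ∀ k : ℕ, 1 ≤ k →
        IsLeast (levelsAbove (periodicPotential ε s α β) k)
          (eigenvalue (periodicPotential ε s α β) k)) ∧
    -- lower bound
    (∀ cβ : ℝ, 0 < cβ → ∃ c : ℝ, 0 < c ∧
      ∀ (ε : ℝ) (N : ℕ) (α β : ℝ) (s : Fin d → ℤ), IsPeriodicSetting d ε N α β →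
      ∀ l : ℕ, 1 ≤ l → cβ * ((l : ℝ) - 1) ^ 2 / ε ^ 2 ≤ β →
        c * ((l : ℝ) - 1) ^ 2 / ε ^ 2 ≤
          eigenvalue (periodicPotential ε s α β) (N * l ^ d + 1)) ∧
    -- upper bound
    (∀ cα : ℝ, 0 < cα → ∃ C : ℝ, 0 < C ∧
      ∀ (ε : ℝ) (N : ℕ) (α β : ℝ) (s : Fin d → ℤ), IsPeriodicSetting d ε N α β →
      α ≤ cα / ε ^ 2 → ∀ l : ℕ, 1 ≤ l →
        eigenvalue (periodicPotential ε s α β) (N * l) ≤ C * (l : ℝ) ^ 2 / ε ^ 2) ∧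
    -- spectral gap
    (∀ cα cβ : ℝ, 0 < cα → 0 < cβ → ∃ C : ℝ, 0 < C ∧
      ∀ (ε : ℝ) (N : ℕ) (α β : ℝ) (s : Fin d → ℤ), IsPeriodicSetting d ε N α β →
      α ≤ cα / ε ^ 2 → ∀ l : ℕ, 1 < l → cβ * ((l : ℝ) - 1) ^ 2 / ε ^ 2 ≤ β →
        (∀ k : ℕ, 1 ≤ k → k < l →
          eigenvalue (periodicPotential ε s α β) (N * k) /
            eigenvalue (periodicPotential ε s α β) (N * l ^ d + 1)
              ≤ C * (k : ℝ) ^ 2 / ((l : ℝ) - 1) ^ 2) ∧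
        eigenvalue (periodicPotential ε s α β) 1 /
            eigenvalue (periodicPotential ε s α β) (N * l ^ d + 1)
              ≤ C / ((l : ℝ) - 1) ^ 2) ∧
    -- the first `N = (2ε)^{-d}` eigenvalues are comparable: no large gap among them
    (∀ cα cβ : ℝ, 0 < cα → 0 < cβ → ∃ C : ℝ, 0 < C ∧
      ∀ (ε : ℝ) (N : ℕ) (α β : ℝ) (s : Fin d → ℤ), IsPeriodicSetting d ε N α β →
      α ≤ cα / ε ^ 2 → cβ / ε ^ 2 ≤ β →
        eigenvalue (periodicPotential ε s α β) N ≤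
          C * eigenvalue (periodicPotential ε s α β) 1) ∧
    -- an arbitrarily large relative gap is reached after `K N = O(ε^{-d})` eigenvalues
    (∀ cα δ : ℝ, 0 < cα → 0 < δ → ∃ (K : ℕ) (B : ℝ), 1 ≤ K ∧ 0 < B ∧
      ∀ (ε : ℝ) (N : ℕ) (α β : ℝ) (s : Fin d → ℤ), IsPeriodicSetting d ε N α β →
      α ≤ cα / ε ^ 2 → B / ε ^ 2 ≤ β →
        eigenvalue (periodicPotential ε s α β) N /
          eigenvalue (periodicPotential ε s α β) (K * N + 1) ≤ δ) := by
  refine ⟨fun ε N α β s h k hk => isLeast_eigenvalue hd s h hk,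
    fun cβ hcβ => exists_eigenvalue_lower_bound hd hcβ,
    fun cα hcα => exists_eigenvalue_upper_bound hd hcα, ?_, ?_, ?_⟩
  · intro cα cβ hcα hcβ
    obtain ⟨c, hc, hlow⟩ := exists_eigenvalue_lower_bound hd hcβ
    obtain ⟨C, hC, hup⟩ := exists_eigenvalue_upper_bound hd hcα
    refine ⟨C / c, by positivity, fun ε N α β s h hα l hl hβ => ?_⟩
    have hl' : (1 : ℝ) < l := by exact_mod_cast hl
    have hb : 0 < ((l : ℝ) - 1) ^ 2 := pow_pos (by linarith) 2
    have h1 := hlow ε N α β s h l hl.le hβ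
    refine ⟨fun k hk _ => div_le_div_of_scaled h.eps_pos hb hc hC (by positivity)
      (hup ε N α β s h hα k hk) h1, ?_⟩
    -- Taking one bump per `α`-cube bounds `E^N` by `C / ε²`, and `E^1 ≤ E^N`.
    have h2 := hup ε N α β s h hα 1 le_rfl
    rw [mul_one, Nat.cast_one, one_pow] at h2
    have h3 := div_le_div_of_scaled h.eps_pos hb hc hC zero_le_one
      ((eigenvalue_one_le hd s h).trans h2) h1
    rwa [mul_one] at h3
  · intro cα cβ hcα hcβ
    obtain ⟨c, hc, hlow⟩ := exists_eigenvalue_one_lower_bound hd hcβ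
    obtain ⟨C, hC, hup⟩ := exists_eigenvalue_upper_bound hd hcα
    refine ⟨C / c, by positivity, fun ε N α β s h hα hβ => ?_⟩
    have h1 := hlow ε N α β s h hβ
    have h2 := hup ε N α β s h hα 1 le_rfl
    rw [mul_one, Nat.cast_one, one_pow, mul_one] at h2
    calc _ ≤ C / ε ^ 2 := h2
      _ = C / c * (c / ε ^ 2) := by field_simp
      _ ≤ _ := mul_le_mul_of_nonneg_left h1 (by positivity)
  · intro cα δ hcα hδ
    obtain ⟨c, hc, hlow⟩ := exists_eigenvalue_lower_bound hd one_pos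
    obtain ⟨C, hC, hup⟩ := exists_eigenvalue_upper_bound hd hcα
    -- With `l = n + 1` and `cβ = 1` the factor `(l - 1)²` is `n²`, which dictates `B = n²` and `K =
    -- (n + 1) ^ d`. The ratio is at most `C / (c n²)`, and `n ≥ 1` reduces this to `C / (c n) < δ`.
    obtain ⟨n, hn⟩ := exists_nat_gt (C / c / δ)
    have hn0 : (0 : ℝ) < n := lt_trans (by positivity) hn
    have hn1 : (1 : ℝ) ≤ n := by exact_mod_cast Nat.succ_le_of_lt (Nat.cast_pos.1 hn0)
    refine ⟨(n + 1) ^ d, (n : ℝ) ^ 2, Nat.one_le_pow _ _ n.succ_pos, by positivity,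
      fun ε N α β s h hα hβ => ?_⟩
    have h1 := hlow ε N α β s h (n + 1) (by omega) (by simpa using hβ)
    have h2 := hup ε N α β s h hα 1 le_rfl
    rw [mul_one, Nat.cast_one, one_pow] at h2
    rw [mul_comm ((n + 1) ^ d) N]
    push_cast at h1
    rw [add_sub_cancel_right] at h1
    refine (div_le_div_of_scaled h.eps_pos (pow_pos hn0 2) hc hC zero_le_one h2 h1).trans ?_
    rw [mul_one, div_le_iff₀ (by positivity)]
    rw [div_lt_iff₀ hδ] at hn
    nlinarith [mul_le_mul_of_nonneg_left hn1 (mul_pos hδ hn0).le]
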